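/- **Theorem 3.** *Setting.* One observes $X_i=\theta_{0,i}+\varepsilon_i$, $1\le i\le n$, with $\theta_0\in\mathbb R^n$ unknown and $\varepsilon_i$ i.i.d. $\mathcal N(0,1)$. Let $\phi$ and $\Phi$ be the standard normal density and distribution function and $\overline\Phi=1-\Phi$. Let $\gamma$ be a positive probability density on $\mathbb R$, unimodal and symmetric about $0$, such that for some $\Lambda$ and some $\kappa\in[1,2]$: $|\log\gamma(x)-\log\gamma(y)|\le\Lambda|x-y|$ for all $x,y\in\mathbb R$; $\gamma(y)^{-1}\int_y^\infty\gamma(u)\,du$ is bounded above and below by positive constant multiples of $y^{\kappa-1}$ for all large $y$; and $y\mapsto y^2\gamma(y)$ is bounded. Put $g(x)=\int\gamma(x-u)\phi(u)\,du$, $\overline G(s)=\int_s^\infty g(x)\,dx$ and $\beta=g/\phi-1$. For $w\in[0,1]$, in the Bayesian model where $\theta_1\sim(1-w)\delta_0+w\gamma(u)\,du$ and $X_1\mid\theta_1\sim\mathcal N(\theta_1,1)$, the $q$-value is $$q(x;w,g)=\Pi(\theta_1=0\mid |X_1|\ge|x|)=\frac{(1-w)\overline\Phi(|x|)}{(1-w)\overline\Phi(|x|)+w\,\overline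 G(|x|)}.$$ Let $\hat w$ be the (almost surely unique) maximiser over $w\in[1/n,1]$ of the marginal log-likelihood $L(w)=\sum_{i=1}^n\log\phi(X_i)+\sum_{i=1}^n\log(1+w\beta(X_i))$. The procedure EBayesq at level $t$ rejects the hypothesis $\theta_{0,i}=0$ if and only if $q(X_i;\hat w,g)\le t$. For a real sequence $(L_n)$ put $\omega_n=L_n/\bigl(n\,\overline G(\sqrt{2.1\log n})\bigr)$; EBayesq.0 rejects $\theta_{0,i}=0$ if and only if $q(X_i;\hat w,g)\le t$ and $\hat w>\omega_n$. For a procedure $\varphi=(\varphi_i)_{1\le i\le n}$ with values in $\{0,1\}^n$, where $\varphi_i=1$ means rejection, $$\mathrm{FDR}(\theta_0,\varphi)=\mathbb E_{\theta_0}\left[\frac{\sum_{i=1}^n\mathbf 1\{\theta_{0,i}=0\}\varphi_i(X)}{1\vee\sum_{i=1}^n\varphi_i(X)}\right].$$ For $a>1$ let $\mathcal L_0[s_n]=\mathcal L_0[s_n;a]$ be the set of $\theta\in\mathbb R^n$ with exactly $s_n$ nonzero coordinates, each satisfying $|\theta_i|\ge a\sqrt{2\log(n/s_n)}$. *Claim.*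 Let $a>1$, let $(s_n)$ be a sequence of nonnegative integers with $s_n\to\infty$ and $s_n\le n^{\upsilon}$ for some $\upsilon\in(0,1)$, and let $t\in(0,1)$. Then for $\varphi$ the procedure EBayesq at level $t$, $$\lim_{n}\sup_{\theta_0\in\mathcal L_0[s_n]}\mathrm{FDR}(\theta_0,\varphi)=\lim_n\inf_{\theta_0\in\mathcal L_0[s_n]}\mathrm{FDR}(\theta_0,\varphi)=t .$$ In addition, for every sequence $L_n\to\infty$, the same two limits hold for EBayesq.0 at level $t$ whenever $s_n/n\ge 2\omega_n$ for all large $n$; and this condition does hold for all large $n$ if $L_n\le\log n$ and $s_n\ge n^{\delta}$ for some fixed $\delta>0$ and all large $n$. -/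

import Mathlib

open MeasureTheory ProbabilityTheory Filter Topology Set Asymptotics
open scoped ENNReal

noncomputable section

namespace SpikeSlab

/-- The assumptions on the slab: `γ` is a positive probability density on `ℝ`, unimodal and
symmetric, with `Λ`-Lipschitz logarithm, tail index `κ ∈ [1, 2]`, and `y ↦ y² γ(y)` bounded.
(A log-Lipschitz function is continuous, so measurability is automatic; integrability follows
from the total mass being `1`.) -/
structure IsSlabDensity (γ : ℝ → ℝ) (Λ κ : ℝ) : Prop where
  pos : ∀ x, 0 < γ x
  integral_eq_one : ∫ x, γ x = 1
  unimodal : ∃ m, MonotoneOn γ (Iic m) ∧ AntitoneOn γ (Ici m)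
  symm : ∀ x, γ (-x) = γ x
  log_lipschitz : ∀ x y, |Real.log (γ x) - Real.log (γ y)| ≤ Λ * |x - y|
  kappa_mem : κ ∈ Icc (1 : ℝ) 2
  tail : (fun y => (γ y)⁻¹ * ∫ u in Ioi y, γ u) =Θ[atTop] fun y => y ^ (κ - 1)
  sq_mul_bounded : ∃ B, ∀ y, y ^ 2 * γ y ≤ B

/-- The standard normal density. -/
def stdPDF (x : ℝ) : ℝ := gaussianPDFReal 0 1 x

/-- The standard normal upper tail `1 - Φ`. -/
def PhiBar (x : ℝ) : ℝ := 1 - cdf (gaussianReal 0 1) x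

/-- The convolution `g` of the slab density with the standard normal density. -/
def convDensity (γ : ℝ → ℝ) (x : ℝ) : ℝ := ∫ u, γ (x - u) * stdPDF u

/-- The upper tail of `g`. -/
def GBar (γ : ℝ → ℝ) (s : ℝ) : ℝ := ∫ x in Ioi s, convDensity γ x

/-- The spike and slab prior `(1 - w) δ₀ + w γ` of one coordinate. -/
def prior (γ : ℝ → ℝ) (w : ℝ) : Measure ℝ :=
  ENNReal.ofReal (1 - w) • Measure.dirac 0 +
    ENNReal.ofReal w • volume.withDensity fun u => ENNReal.ofReal (γ u)

/-- The Bayesian joint law of `(θ₁, X₁)`: `θ₁` follows the prior and `X₁ = θ₁ + ε₁` with an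
independent standard normal `ε₁`. -/
def jointLaw (γ : ℝ → ℝ) (w : ℝ) : Measure (ℝ × ℝ) :=
  ((prior γ w).prod (gaussianReal 0 1)).map fun p => (p.1, p.1 + p.2)

/-- The `q`-value `q(x; w, g) = Π(θ₁ = 0 | |X₁| ≥ |x|)`. -/
def qValue (γ : ℝ → ℝ) (w x : ℝ) : ℝ :=
  ((jointLaw γ w)[|{p : ℝ × ℝ | |x| ≤ |p.2|}]).real {p : ℝ × ℝ | p.1 = 0}

/-- `β = g/φ - 1`. -/
def beta (γ : ℝ → ℝ) (x : ℝ) : ℝ := convDensity γ x / stdPDF x - 1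

/-- The marginal log-likelihood of `w`, that is `log ∏ᵢ ((1 - w) φ(Xᵢ) + w g(Xᵢ))`. -/
def logLik {n : ℕ} (γ : ℝ → ℝ) (x : Fin n → ℝ) (w : ℝ) : ℝ :=
  ∑ i, Real.log (stdPDF (x i)) + ∑ i, Real.log (1 + w * beta γ (x i))

/-- The marginal maximum likelihood estimator `ŵ`, the maximiser of the log-likelihood over
`[1/n, 1]`. The maximiser is almost surely unique; on the exceptional null set the largest
one is taken. -/
def wHat {n : ℕ} (γ : ℝ → ℝ) (x : Fin n → ℝ) : ℝ :=
  sSup {w | w ∈ Icc (1 / (n : ℝ)) 1 ∧ IsMaxOn (logLik γ x) (Icc (1 / (n : ℝ)) 1) w}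

/-- The procedure EBayesq: the set of indices `i` rejected from the data `x`, namely those with
`q(xᵢ; ŵ, g) ≤ t`. -/
def eBayesQ {n : ℕ} (γ : ℝ → ℝ) (t : ℝ) (x : Fin n → ℝ) : Finset (Fin n) :=
  open Classical in {i | qValue γ (wHat γ x) (x i) ≤ t}

/-- The cut-off `ω = ℓ / (n Ḡ(√(2.1 log n)))`. -/
def omega (γ : ℝ → ℝ) (n : ℕ) (ℓ : ℝ) : ℝ :=
  ℓ / (n * GBar γ (Real.sqrt (2.1 * Real.log n)))

/-- The procedure EBayesq.0: as EBayesq, but nothing is rejected unless `ŵ > ω`. -/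
def eBayesQZero {n : ℕ} (γ : ℝ → ℝ) (t ℓ : ℝ) (x : Fin n → ℝ) : Finset (Fin n) :=
  open Classical in {i | qValue γ (wHat γ x) (x i) ≤ t ∧ omega γ n ℓ < wHat γ x}

/-- The law of the data: `Xᵢ = θᵢ + εᵢ` with i.i.d. standard normal `εᵢ`. -/
def dataLaw {n : ℕ} (θ : Fin n → ℝ) : Measure (Fin n → ℝ) :=
  Measure.pi fun i => gaussianReal (θ i) 1

/-- The false discovery rate at `θ` of a procedure returning the set of rejected indices. -/
def FDR {n : ℕ} (θ : Fin n → ℝ) (φ : (Fin n → ℝ) → Finset (Fin n)) : ℝ :=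
  ∫ x, (((φ x).filter fun i => θ i = 0).card : ℝ) / max 1 ((φ x).card : ℝ) ∂(dataLaw θ)

/-- The class of vectors of `ℝⁿ` with exactly `s` nonzero entries, each of absolute value at
least `a √(2 log (n / s))`. -/
def largeSignals (n s : ℕ) (a : ℝ) : Set (Fin n → ℝ) :=
  {θ | (∀ i, θ i ≠ 0 → a * Real.sqrt (2 * Real.log ((n : ℝ) / s)) ≤ |θ i|) ∧
    (Finset.univ.filter fun i => θ i ≠ 0).card = s}

lemma measurable_slab {γ : ℝ → ℝ} {Λ κ : ℝ} (h : IsSlabDensity γ Λ κ) : Measurable γ := by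
  have hc : Continuous fun x => Real.log (γ x) := by
    have : LipschitzWith (Real.toNNReal Λ) fun x => Real.log (γ x) := by
      refine LipschitzWith.of_dist_le_mul fun x y => ?_
      rw [Real.dist_eq, Real.dist_eq]
      exact (h.log_lipschitz x y).trans
        (mul_le_mul_of_nonneg_right (Real.le_coe_toNNReal Λ) (abs_nonneg _))
    exact this.continuous
  have : γ = fun x => Real.exp (Real.log (γ x)) := by
    funext x; rw [Real.exp_log (h.pos x)]
  rw [this]
  exact (Real.continuous_exp.comp hc).measurable

/-- A symmetric atomless measure charges both tails equally. -/
lemma two_sided {μ : Measure ℝ} [NullSingletonClass μ] (hμ : μ.map (fun x => -x) = μ) {c : ℝ} (hc : 0 ≤ c) :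
    μ {y | c ≤ |y|} = 2 * μ (Ioi c) := by
  have h1 : {y : ℝ | c ≤ |y|} = Iic (-c) ∪ Ici c := by
    ext y; simp only [mem_ofPred_eq, le_abs, mem_union, mem_Iic, mem_Ici]
    constructor
    · rintro (h | h)
      · exact Or.inr h
      · exact Or.inl (by linarith)
    · rintro (h | h)
      · exact Or.inr (by linarith)
      · exact Or.inl h
  have h2 : AEDisjoint μ (Iic (-c)) (Ici c) := by
    refine measure_mono_null (t := {0}) ?_ (measure_singleton 0)
    rintro y ⟨hy1, hy2⟩
    simp only [mem_Iic, mem_Ici] at hy1 hy2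
    simp only [mem_singleton_iff]; linarith
  have h3 : μ (Iic (-c)) = μ (Ioi c) := by
    conv_lhs => rw [← hμ]
    rw [Measure.map_apply measurable_neg measurableSet_Iic]
    have : (fun x : ℝ => -x) ⁻¹' Iic (-c) = Ici c := by ext; simp
    rw [this]; exact (measure_congr Ioi_ae_eq_Ici).symm
  have h4 : μ (Ici c) = μ (Ioi c) := (measure_congr Ioi_ae_eq_Ici).symm
  rw [h1, measure_union₀ measurableSet_Ici.nullMeasurableSet h2, h3, h4, two_mul]

lemma gauss_tail {c : ℝ} (hc : 0 ≤ c) :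
    gaussianReal 0 1 {y | c ≤ |y|} = ENNReal.ofReal (2 * PhiBar c) := by
  have hN : NullSingletonClass (gaussianReal 0 1) := nullSingletonClass_gaussianReal one_ne_zero
  rw [two_sided (by simpa using gaussianReal_map_neg (μ := 0) (v := 1)) hc,
    ENNReal.ofReal_mul (by norm_num)]
  have : PhiBar c = (gaussianReal 0 1).real (Ioi c) := by
    rw [PhiBar, cdf_eq_real, ← compl_Iic, probReal_compl_eq_one_sub measurableSet_Iic]
  rw [this, ofReal_measureReal]
  simp

lemma ofReal_convDensity {γ : ℝ → ℝ} {Λ κ : ℝ} (h : IsSlabDensity γ Λ κ) (x : ℝ) :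
    ENNReal.ofReal (convDensity γ x) =
      ∫⁻ u, ENNReal.ofReal (γ u) * gaussianPDF 0 1 (x - u) := by
  have hm := measurable_slab h
  have hi : Integrable γ := by
    by_contra hn
    have := h.integral_eq_one
    rw [integral_undef hn] at this
    norm_num at this
  have hI : Integrable fun u => γ (x - u) * stdPDF u := by
    refine Integrable.mul_bdd (c := (√(2 * Real.pi))⁻¹) (hi.comp_sub_left x)
      (measurable_gaussianPDFReal 0 1).aestronglyMeasurable (ae_of_all _ fun u => ?_)
    rw [stdPDF, Real.norm_of_nonneg (gaussianPDFReal_nonneg 0 1 u), gaussianPDFReal]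
    have : Real.exp (-(u - 0) ^ 2 / (2 * ((1 : NNReal) : ℝ))) ≤ 1 := by
      rw [Real.exp_le_one_iff]
      have := sq_nonneg (u - 0)
      push_cast
      linarith
    have h0 : 0 ≤ (√(2 * Real.pi))⁻¹ := by positivity
    simpa using mul_le_mul_of_nonneg_left this h0
  rw [convDensity, ofReal_integral_eq_lintegral_ofReal hI
    (ae_of_all _ fun u => mul_nonneg (h.pos _).le (gaussianPDFReal_nonneg 0 1 u)),
    ← lintegral_sub_left_eq_self _ x]
  refine lintegral_congr fun u => ?_
  rw [ENNReal.ofReal_mul (h.pos _).le, sub_sub_cancel]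
  rfl

lemma convDensity_nonneg {γ : ℝ → ℝ} {Λ κ : ℝ} (h : IsSlabDensity γ Λ κ) (x : ℝ) :
    0 ≤ convDensity γ x :=
  integral_nonneg fun _ => mul_nonneg (h.pos _).le (gaussianPDFReal_nonneg 0 1 _)

lemma convDensity_neg {γ : ℝ → ℝ} {Λ κ : ℝ} (h : IsSlabDensity γ Λ κ) (x : ℝ) :
    convDensity γ (-x) = convDensity γ x := by
  rw [convDensity, convDensity, ← integral_neg_eq_self]
  refine integral_congr_ae (ae_of_all _ fun u => ?_)
  have h1 : γ (-x - -u) = γ (x - u) := by rw [← h.symm]; congr 1; ring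
  have h2 : stdPDF (-u) = stdPDF u := by simp [stdPDF, gaussianPDFReal]
  simp only [h1, h2]

lemma measurable_kernel {γ : ℝ → ℝ} {Λ κ : ℝ} (h : IsSlabDensity γ Λ κ) :
    Measurable fun p : ℝ × ℝ => ENNReal.ofReal (γ p.2) * gaussianPDF 0 1 (p.1 - p.2) :=
  ((measurable_slab h).comp measurable_snd).ennreal_ofReal.mul
    ((measurable_gaussianPDF 0 1).comp (measurable_fst.sub measurable_snd))

lemma measurable_ofReal_conv {γ : ℝ → ℝ} {Λ κ : ℝ} (h : IsSlabDensity γ Λ κ) :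
    Measurable fun x => ENNReal.ofReal (convDensity γ x) := by
  simp_rw [ofReal_convDensity h]
  exact (measurable_kernel h).lintegral_prod_right'

/-- Under the slab, the law of `X₁` has density `g`. -/
lemma slab_law {γ : ℝ → ℝ} {Λ κ : ℝ} (h : IsSlabDensity γ Λ κ) {A : Set ℝ}
    (hA : MeasurableSet A) :
    ∫⁻ u, ENNReal.ofReal (γ u) * gaussianReal 0 1 {y | u + y ∈ A} =
      ∫⁻ x in A, ENNReal.ofReal (convDensity γ x) := by
  simp_rw [ofReal_convDensity h]
  rw [lintegral_lintegral_swap (measurable_kernel h).aemeasurable]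
  refine lintegral_congr fun u => ?_
  have hmu : Measurable fun x : ℝ => gaussianPDF 0 1 (x - u) :=
    (measurable_gaussianPDF 0 1).comp (measurable_id.sub measurable_const)
  rw [lintegral_const_mul _ hmu]
  congr 1
  have hB : MeasurableSet {y : ℝ | u + y ∈ A} := measurable_const_add u hA
  rw [gaussianReal_apply 0 one_ne_zero, ← lintegral_indicator hB, ← lintegral_indicator hA,
    ← lintegral_add_left_eq_self (A.indicator fun a => gaussianPDF 0 1 (a - u)) u]
  refine lintegral_congr fun y => ?_
  by_cases hy : u + y ∈ A
  · rw [indicator_of_mem hy, indicator_of_mem (by exact hy), add_sub_cancel_left]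
  · rw [indicator_of_notMem hy, indicator_of_notMem (by exact hy)]

lemma slab_tail {γ : ℝ → ℝ} {Λ κ : ℝ} (h : IsSlabDensity γ Λ κ) {c : ℝ} (hc : 0 ≤ c) :
    ∫⁻ u, ENNReal.ofReal (γ u) * gaussianReal 0 1 {y | c ≤ |u + y|} =
      ENNReal.ofReal (2 * GBar γ c) := by
  have hmg := measurable_ofReal_conv h
  have hA : MeasurableSet {x : ℝ | c ≤ |x|} := measurableSet_le measurable_const measurable_abs
  have htot : ∫⁻ x, ENNReal.ofReal (convDensity γ x) ≠ ∞ := by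
    have := slab_law h MeasurableSet.univ
    simp only [mem_univ, ofPred_true, measure_univ, mul_one, Measure.restrict_univ] at this
    rw [← this]
    have hi : Integrable γ := by
      by_contra hn
      have h1 := h.integral_eq_one
      rw [integral_undef hn] at h1
      norm_num at h1
    exact hi.lintegral_lt_top.ne
  have key := slab_law h hA
  simp only [mem_ofPred_eq] at key
  rw [key, ← withDensity_apply _ hA, two_sided ?_ hc, withDensity_apply _ measurableSet_Ioi,
    ENNReal.ofReal_mul (by norm_num), GBar, integral_eq_lintegral_of_nonneg_ae
      (ae_of_all _ fun x => convDensity_nonneg h x), ENNReal.ofReal_toReal]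
  · simp
  · exact ne_top_of_le_ne_top htot (setLIntegral_le_lintegral _ _)
  · have : convDensity γ = fun x => (ENNReal.ofReal (convDensity γ x)).toReal := by
      funext x; rw [ENNReal.toReal_ofReal (convDensity_nonneg h x)]
    rw [this]
    exact hmg.ennreal_toReal.aestronglyMeasurable
  · ext B hB
    rw [Measure.map_apply measurable_neg hB, withDensity_apply _ (measurable_neg hB),
      withDensity_apply _ hB, ← lintegral_indicator (measurable_neg hB), ← lintegral_indicator hB,
      ← lintegral_neg_eq_self]
    refine lintegral_congr fun x => ?_
    by_cases hx : x ∈ B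
    · rw [indicator_of_mem hx, indicator_of_mem (by simpa using hx), convDensity_neg h]
    · rw [indicator_of_notMem hx, indicator_of_notMem (by simpa using hx)]

lemma lintegral_prior {γ : ℝ → ℝ} {Λ κ : ℝ} (h : IsSlabDensity γ Λ κ) (w : ℝ) {f : ℝ → ℝ≥0∞}
    (hf : Measurable f) :
    ∫⁻ u, f u ∂(prior γ w) =
      ENNReal.ofReal (1 - w) * f 0 + ENNReal.ofReal w * ∫⁻ u, ENNReal.ofReal (γ u) * f u := by
  rw [prior, lintegral_add_measure, lintegral_smul_measure, lintegral_smul_measure,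
    lintegral_dirac' _ hf,
    lintegral_withDensity_eq_lintegral_mul _ (measurable_slab h).ennreal_ofReal hf]
  rfl

lemma PhiBar_nonneg (c : ℝ) : 0 ≤ PhiBar c := sub_nonneg.2 (cdf_le_one _ c)

lemma GBar_nonneg {γ : ℝ → ℝ} {Λ κ : ℝ} (h : IsSlabDensity γ Λ κ) (c : ℝ) : 0 ≤ GBar γ c :=
  integral_nonneg fun x => convDensity_nonneg h x

/-- The `q`-value in terms of the tails of `φ` and `g`. -/
theorem qValue_eq {γ : ℝ → ℝ} {Λ κ : ℝ} (h : IsSlabDensity γ Λ κ) {w : ℝ}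
    (hw : w ∈ Icc (0 : ℝ) 1) (x : ℝ) :
    qValue γ w x = (1 - w) * PhiBar |x| / ((1 - w) * PhiBar |x| + w * GBar γ |x|) := by
  have hw1 : 0 ≤ 1 - w := sub_nonneg.2 hw.2
  have hP := PhiBar_nonneg |x|
  have hG := GBar_nonneg h |x|
  have hT : Measurable fun p : ℝ × ℝ => (p.1, p.1 + p.2) :=
    measurable_fst.prodMk (measurable_fst.add measurable_snd)
  have hA : MeasurableSet {p : ℝ × ℝ | |x| ≤ |p.2|} :=
    measurableSet_le measurable_const measurable_snd.abs
  have h0 : MeasurableSet {p : ℝ × ℝ | p.1 = 0} := measurable_fst (measurableSet_singleton 0)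
  have joint : ∀ S : Set (ℝ × ℝ), MeasurableSet S → jointLaw γ w S =
      ENNReal.ofReal (1 - w) * gaussianReal 0 1 {y | (0, 0 + y) ∈ S} +
      ENNReal.ofReal w *
        ∫⁻ u, ENNReal.ofReal (γ u) * gaussianReal 0 1 {y | (u, u + y) ∈ S} := by
    intro S hS
    have hS' := hT hS
    have : SFinite (prior γ w) := by unfold prior; infer_instance
    rw [jointLaw, Measure.map_apply hT hS, Measure.prod_apply hS',
      lintegral_prior h w (measurable_measure_prodMk_left hS')]
    rfl
  have e1 : jointLaw γ w {p : ℝ × ℝ | |x| ≤ |p.2|} =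
      ENNReal.ofReal (2 * ((1 - w) * PhiBar |x| + w * GBar γ |x|)) := by
    rw [joint _ hA]
    simp only [mem_ofPred_eq, zero_add]
    rw [gauss_tail (abs_nonneg x), slab_tail h (abs_nonneg x), ← ENNReal.ofReal_mul hw1,
      ← ENNReal.ofReal_mul hw.1, ← ENNReal.ofReal_add (by positivity)
        (mul_nonneg hw.1 (by positivity))]
    congr 1; ring
  have e2 : jointLaw γ w ({p : ℝ × ℝ | |x| ≤ |p.2|} ∩ {p : ℝ × ℝ | p.1 = 0}) =
      ENNReal.ofReal (2 * ((1 - w) * PhiBar |x|)) := by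
    rw [joint _ (hA.inter h0)]
    have z : ∫⁻ u, ENNReal.ofReal (γ u) * gaussianReal 0 1
        {y | (u, u + y) ∈ {p : ℝ × ℝ | |x| ≤ |p.2|} ∩ {p : ℝ × ℝ | p.1 = 0}} = 0 := by
      rw [← lintegral_zero (α := ℝ) (μ := volume)]
      refine lintegral_congr_ae ?_
      have : ∀ᵐ u : ℝ, u ≠ 0 := by simp [ae_iff]
      filter_upwards [this] with u hu
      simp [hu]
    rw [z, mul_zero, add_zero]
    simp only [mem_inter_iff, mem_ofPred_eq, zero_add, and_true]
    rw [gauss_tail (abs_nonneg x), ← ENNReal.ofReal_mul hw1]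
    congr 1; ring
  have hD : 0 ≤ (1 - w) * PhiBar |x| + w * GBar γ |x| :=
    add_nonneg (mul_nonneg hw1 hP) (mul_nonneg hw.1 hG)
  rw [qValue, Measure.real, cond_apply hA, e1, e2, ENNReal.toReal_mul, ENNReal.toReal_inv,
    ENNReal.toReal_ofReal (by positivity), ENNReal.toReal_ofReal (by positivity), inv_mul_eq_div,
    mul_div_mul_left _ _ (by norm_num : (2 : ℝ) ≠ 0)]

end SpikeSlab

end

/-! Write `c = t / (1 - t)`. For a fixed weight `w` the rule `q ≤ t` is a threshold rule `|x| ≥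
ξ(w)` with `(1 - w) Φ̄(ξ) = c w Ḡ(ξ)`, because `Φ̄ / Ḡ` is nonincreasing (`exists_threshold`). The
score of the marginal likelihood at `w` is `(n - ∑ invRatio γ w (Xᵢ)) / w`. A null coordinate
contributes `1 + excess γ w` to the sum on average, and a strong signal contributes almost nothing,
so the score vanishes near the deterministic weight `w` with `excess γ w = s / n`. Concavity and
Chebyshev's inequality then place `ŵ` in `[(1 - δ) w, (1 + δ) w]` with high probability
(`wHat_mem_Icc`).

The analytic heart is `excess γ w ~ 2 w Ḡ(ξ(w))` as `w → 0` (`eventually_half_excess_le`,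
`eventually_le_half_excess`): beyond `ξ` the integrand `(wβ)² φ / (1 + wβ)` is nearly `w g`, while
below `ξ` it decays geometrically away from `ξ`. Hence `2 Φ̄(ξ) ~ c · excess γ w`, and at the target
weight the expected number of false rejections is about `c s` (`exists_weight_threshold`,
`null_count_mean_bounds`).

This same relation gives `ξ ≤ √(2 log(n/s)) + O(1)`, so `a > 1` makes nearly all `s` signals
detected. The false discovery proportion is then close to `c s / (c s + s) = t`, uniformly over the
class (`abs_FDR_sub_le`, `eventually_abs_FDR_sub_le`). For EBayesq.0, `s / n < 2 ŵ` on the typical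
event, so the extra condition `ŵ > ω` is automatic when `2 ω ≤ s / n`. -/

noncomputable section

namespace SpikeSlab

variable {γ : ℝ → ℝ} {Λ κ : ℝ}

/-! ### Tail integrals on half-lines -/

lemma integral_Ioi_comp_sub (f : ℝ → ℝ) (x a : ℝ) :
    ∫ u in Ioi (x + a), f (u - a) = ∫ u in Ioi x, f u := by
  have := (measurePreserving_sub_right volume a).setIntegral_preimage_emb
    (MeasurableEquiv.subRight a).measurableEmbedding f (Ioi x)
  rw [← this]
  congr 2
  ext u; simp

lemma continuous_integral_Ioi {f : ℝ → ℝ} (hf : Integrable f) :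
    Continuous fun x => ∫ u in Ioi x, f u := by
  have : (fun x => ∫ u in Ioi x, f u) = fun x => (∫ u in Ioi 0, f u) - ∫ u in (0 : ℝ)..x, f u := by
    funext x
    rw [← intervalIntegral.integral_Ioi_sub_Ioi' hf.integrableOn hf.integrableOn]
    ring
  rw [this]
  exact continuous_const.sub (intervalIntegral.continuous_primitive
    (fun a b => hf.intervalIntegrable) 0)

/-- Tails of a log-Lipschitz function. -/
lemma integral_Ioi_le_exp_mul {f : ℝ → ℝ} (hf : Integrable f) {Λ : ℝ}
    (hL : ∀ x y, f x ≤ Real.exp (Λ * |x - y|) * f y) {x y : ℝ} (hxy : x ≤ y) :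
    ∫ u in Ioi x, f u ≤ Real.exp (Λ * (y - x)) * ∫ u in Ioi y, f u := by
  have h1 := integral_Ioi_comp_sub f x (y - x)
  rw [add_sub_cancel] at h1
  rw [← h1, ← integral_const_mul]
  refine setIntegral_mono_on (hf.comp_sub_right _).integrableOn
    (hf.const_mul _).integrableOn measurableSet_Ioi fun u _ => ?_
  have := hL (u - (y - x)) u
  rwa [show u - (y - x) - u = -(y - x) by ring, abs_neg, abs_of_nonneg (sub_nonneg.2 hxy)] at this

/-! ### The standard normal density and its tail -/

lemma stdPDF_eq (x : ℝ) : stdPDF x = (√(2 * Real.pi))⁻¹ * Real.exp (-(x ^ 2 / 2)) := by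
  simp [stdPDF, gaussianPDFReal]; ring_nf; trivial

lemma stdPDF_pos (x : ℝ) : 0 < stdPDF x := gaussianPDFReal_pos 0 1 x one_ne_zero

lemma integrable_stdPDF : Integrable stdPDF := integrable_gaussianPDFReal 0 1

lemma measurable_stdPDF : Measurable stdPDF := measurable_gaussianPDFReal 0 1

lemma integral_stdPDF : ∫ x, stdPDF x = 1 := integral_gaussianPDFReal_eq_one 0 one_ne_zero

lemma stdPDF_neg (x : ℝ) : stdPDF (-x) = stdPDF x := by simp [stdPDF_eq]

lemma stdPDF_abs (x : ℝ) : stdPDF |x| = stdPDF x := by simp [stdPDF_eq]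

/-- The ratio of the normal density at two points. -/
lemma stdPDF_eq_exp_mul (x y : ℝ) :
    stdPDF x = Real.exp ((y ^ 2 - x ^ 2) / 2) * stdPDF y := by
  rw [stdPDF_eq, stdPDF_eq, mul_left_comm, ← Real.exp_add]; ring_nf

lemma stdPDF_le_exp (x : ℝ) : stdPDF x ≤ Real.exp (-(x ^ 2 / 2)) / 2 := by
  rw [stdPDF_eq, div_eq_inv_mul (Real.exp _)]
  refine mul_le_mul_of_nonneg_right ?_ (Real.exp_pos _).le
  refine inv_anti₀ (by norm_num) (Real.le_sqrt_of_sq_le ?_)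
  nlinarith [Real.pi_gt_three]

lemma stdPDF_anti {x y : ℝ} (hx : 0 ≤ x) (hxy : x ≤ y) : stdPDF y ≤ stdPDF x := by
  rw [stdPDF_eq, stdPDF_eq]
  gcongr

lemma PhiBar_eq_integral (x : ℝ) : PhiBar x = ∫ u in Ioi x, stdPDF u := by
  have : PhiBar x = (gaussianReal 0 1).real (Ioi x) := by
    rw [PhiBar, cdf_eq_real, ← compl_Iic, probReal_compl_eq_one_sub measurableSet_Iic]
  rw [this, Measure.real, gaussianReal_apply_eq_integral 0 one_ne_zero,
    ENNReal.toReal_ofReal (integral_nonneg fun u => gaussianPDFReal_nonneg 0 1 u)]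
  rfl

lemma continuous_PhiBar : Continuous PhiBar := by
  have : PhiBar = fun x => ∫ u in Ioi x, stdPDF u := funext PhiBar_eq_integral
  rw [this]; exact continuous_integral_Ioi integrable_stdPDF

lemma mul_stdPDF_le_PhiBar {x η : ℝ} (hx : 0 ≤ x) (hη : 0 ≤ η) :
    η * stdPDF (x + η) ≤ PhiBar x := by
  rw [PhiBar_eq_integral]
  calc η * stdPDF (x + η) = ∫ _ in Ioc x (x + η), stdPDF (x + η) := by simp [hη]
    _ ≤ ∫ u in Ioc x (x + η), stdPDF u := by
        refine setIntegral_mono_on (integrable_const _) integrable_stdPDF.integrableOn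
          measurableSet_Ioc fun u hu => stdPDF_anti (hx.trans hu.1.le) hu.2
    _ ≤ _ := setIntegral_mono_set integrable_stdPDF.integrableOn
        (ae_of_all _ fun u => (stdPDF_pos u).le) (Ioc_subset_Ioi_self.eventuallyLE)

lemma PhiBar_pos {x : ℝ} (hx : 0 ≤ x) : 0 < PhiBar x :=
  (mul_pos one_pos (stdPDF_pos _)).trans_le (mul_stdPDF_le_PhiBar hx zero_le_one)

/-- Mills' bound: `(u - x)² ≥ 0` gives `φ(u) ≤ φ(x) e^{-x(u - x)}`, whose integral over `u > x` is
`φ(x) / x`. -/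
lemma PhiBar_le_stdPDF {x : ℝ} (hx : 1 ≤ x) : PhiBar x ≤ stdPDF x := by
  rw [PhiBar_eq_integral]
  have hx0 : -x < 0 := by linarith
  have h1 : ∫ u in Ioi x, stdPDF x * Real.exp (x * x) * Real.exp (-x * u) = stdPDF x / x := by
    rw [integral_const_mul, integral_exp_mul_Ioi hx0, neg_div_neg_eq, mul_div_assoc', mul_assoc,
      ← Real.exp_add]
    simp
  calc ∫ u in Ioi x, stdPDF u
      ≤ ∫ u in Ioi x, stdPDF x * Real.exp (x * x) * Real.exp (-x * u) := by
        refine setIntegral_mono_on integrable_stdPDF.integrableOn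
          ((integrableOn_exp_mul_Ioi hx0 x).const_mul _) measurableSet_Ioi fun u _ => ?_
        rw [stdPDF_eq_exp_mul u x, mul_assoc, mul_comm, ← Real.exp_add]
        refine mul_le_mul_of_nonneg_left (Real.exp_le_exp.2 ?_) (stdPDF_pos x).le
        nlinarith [sq_nonneg (u - x)]
    _ = stdPDF x / x := h1
    _ ≤ stdPDF x := div_le_self (stdPDF_pos x).le hx

lemma two_mul_PhiBar_le_exp {x : ℝ} (hx : 1 ≤ x) : 2 * PhiBar x ≤ Real.exp (-(x ^ 2 / 2)) := by
  linarith [PhiBar_le_stdPDF hx, stdPDF_le_exp x]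

lemma gaussianReal_real_abs_ge {c : ℝ} (hc : 0 ≤ c) :
    (gaussianReal 0 1).real {y | c ≤ |y|} = 2 * PhiBar c := by
  rw [Measure.real, gauss_tail hc, ENNReal.toReal_ofReal (by linarith [PhiBar_nonneg c])]

lemma integrable_exp_mul_abs_stdPDF (c : ℝ) :
    Integrable fun u => Real.exp (c * |u|) * stdPDF u := by
  have h := integrable_exp_mul_abs (t := c) (X := id) (μ := gaussianReal 0 1)
    (integrable_exp_mul_gaussianReal _) (integrable_exp_mul_gaussianReal _)
  rw [gaussianReal_of_var_ne_zero 0 one_ne_zero,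
    integrable_withDensity_iff_integrable_smul' (measurable_gaussianPDF _ _)
      (ae_of_all _ fun _ => gaussianPDF_lt_top)] at h
  refine h.congr (ae_of_all _ fun u => ?_)
  simp [mul_comm, stdPDF]

/-! ### The slab and its convolution with the normal density -/

lemma IsSlabDensity.integrable (h : IsSlabDensity γ Λ κ) : Integrable γ := by
  by_contra hn
  have := h.integral_eq_one
  rw [integral_undef hn] at this
  norm_num at this

lemma IsSlabDensity.lipschitz_const_nonneg (h : IsSlabDensity γ Λ κ) : 0 ≤ Λ := by
  have := (abs_nonneg _).trans (h.log_lipschitz 0 1)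
  simpa using this

lemma IsSlabDensity.le_exp_mul (h : IsSlabDensity γ Λ κ) (x y : ℝ) :
    γ x ≤ Real.exp (Λ * |x - y|) * γ y := by
  have h1 := (abs_le.1 (h.log_lipschitz x y)).2
  calc γ x = Real.exp (Real.log (γ x)) := (Real.exp_log (h.pos x)).symm
    _ ≤ Real.exp (Λ * |x - y| + Real.log (γ y)) := Real.exp_le_exp.2 (by linarith)
    _ = _ := by rw [Real.exp_add, Real.exp_log (h.pos y)]

lemma integrable_slab_mul_stdPDF (h : IsSlabDensity γ Λ κ) (x : ℝ) :
    Integrable fun u => γ (x - u) * stdPDF u := by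
  refine Integrable.mul_bdd (c := 1) (h.integrable.comp_sub_left x)
    measurable_stdPDF.aestronglyMeasurable (ae_of_all _ fun u => ?_)
  rw [Real.norm_of_nonneg (stdPDF_pos u).le]
  have h1 := stdPDF_le_exp u
  have h2 : Real.exp (-(u ^ 2 / 2)) ≤ 1 := Real.exp_le_one_iff.2 (by nlinarith [sq_nonneg u])
  linarith

/-- Averaging translates of `γ` keeps the log-Lipschitz constant, so `g` varies as slowly as `γ`. -/
lemma convDensity_le_exp_mul (h : IsSlabDensity γ Λ κ) (x y : ℝ) :
    convDensity γ x ≤ Real.exp (Λ * |x - y|) * convDensity γ y := by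
  rw [convDensity, convDensity, ← integral_const_mul]
  refine integral_mono (integrable_slab_mul_stdPDF h x)
    ((integrable_slab_mul_stdPDF h y).const_mul _) fun u => ?_
  have := h.le_exp_mul (x - u) (y - u)
  rw [sub_sub_sub_cancel_right] at this
  calc γ (x - u) * stdPDF u ≤ _ := mul_le_mul_of_nonneg_right this (stdPDF_pos u).le
    _ = _ := by ring

lemma convDensity_pos (h : IsSlabDensity γ Λ κ) (x : ℝ) : 0 < convDensity γ x := by
  refine (integral_pos_iff_support_of_nonneg
    (fun u => (mul_pos (h.pos _) (stdPDF_pos u)).le) (integrable_slab_mul_stdPDF h x)).2 ?_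
  have : (Function.support fun u => γ (x - u) * stdPDF u) = univ :=
    eq_univ_of_forall fun u => (mul_pos (h.pos _) (stdPDF_pos u)).ne'
  simp [this]

lemma measurable_convDensity (h : IsSlabDensity γ Λ κ) : Measurable (convDensity γ) := by
  have : convDensity γ = fun x => (ENNReal.ofReal (convDensity γ x)).toReal := by
    funext x; rw [ENNReal.toReal_ofReal (convDensity_nonneg h x)]
  rw [this]
  exact (measurable_ofReal_conv h).ennreal_toReal

lemma lintegral_convDensity (h : IsSlabDensity γ Λ κ) :
    ∫⁻ x, ENNReal.ofReal (convDensity γ x) = 1 := by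
  have := slab_law h MeasurableSet.univ
  simp only [mem_univ, ofPred_true, measure_univ, mul_one, Measure.restrict_univ] at this
  rw [← this, ← ofReal_integral_eq_lintegral_ofReal h.integrable (ae_of_all _ fun x => (h.pos x).le),
    h.integral_eq_one, ENNReal.ofReal_one]

lemma integrable_convDensity (h : IsSlabDensity γ Λ κ) : Integrable (convDensity γ) := by
  refine ⟨(measurable_convDensity h).aestronglyMeasurable, ?_⟩
  rw [hasFiniteIntegral_iff_ofReal (ae_of_all _ (convDensity_nonneg h)), lintegral_convDensity h]
  exact ENNReal.one_lt_top

lemma integral_convDensity (h : IsSlabDensity γ Λ κ) : ∫ x, convDensity γ x = 1 := by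
  rw [integral_eq_lintegral_of_nonneg_ae (ae_of_all _ (convDensity_nonneg h))
    (measurable_convDensity h).aestronglyMeasurable, lintegral_convDensity h, ENNReal.toReal_one]

lemma continuous_GBar (h : IsSlabDensity γ Λ κ) : Continuous (GBar γ) :=
  continuous_integral_Ioi (integrable_convDensity h)

lemma GBar_le_exp_mul (h : IsSlabDensity γ Λ κ) {x y : ℝ} (hxy : x ≤ y) :
    GBar γ x ≤ Real.exp (Λ * (y - x)) * GBar γ y :=
  integral_Ioi_le_exp_mul (integrable_convDensity h) (convDensity_le_exp_mul h) hxy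

/-- On the unit interval to the right of `x`, `g` drops by a factor of at most `e^Λ`. -/
lemma convDensity_le_GBar (h : IsSlabDensity γ Λ κ) (x : ℝ) :
    convDensity γ x ≤ Real.exp Λ * GBar γ x := by
  have hi := integrable_convDensity h
  calc convDensity γ x = ∫ _ in Ioc x (x + 1), convDensity γ x := by simp
    _ ≤ ∫ u in Ioc x (x + 1), Real.exp Λ * convDensity γ u := by
        refine setIntegral_mono_on (integrable_const _) (hi.const_mul _).integrableOn
          measurableSet_Ioc fun u hu => (convDensity_le_exp_mul h x u).trans ?_
        refine mul_le_mul_of_nonneg_right (Real.exp_le_exp.2 ?_) (convDensity_nonneg h u)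
        refine mul_le_of_le_one_right h.lipschitz_const_nonneg ?_
        rw [abs_le]; constructor <;> linarith [hu.1, hu.2]
    _ = Real.exp Λ * ∫ u in Ioc x (x + 1), convDensity γ u := integral_const_mul _ _
    _ ≤ _ := mul_le_mul_of_nonneg_left (setIntegral_mono_set hi.integrableOn
        (ae_of_all _ (convDensity_nonneg h)) (Ioc_subset_Ioi_self.eventuallyLE))
        (Real.exp_pos _).le

lemma GBar_pos (h : IsSlabDensity γ Λ κ) (x : ℝ) : 0 < GBar γ x :=
  pos_of_mul_pos_right ((convDensity_pos h x).trans_le (convDensity_le_GBar h x))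
    (Real.exp_pos _).le

/-- An at most exponential decay of `Ḡ`: this is what makes it dominate Gaussian tails and keeps
`Ḡ(√(2.1 log n))` above every negative power of `n`. -/
lemma GBar_zero_le (h : IsSlabDensity γ Λ κ) {x : ℝ} (hx : 0 ≤ x) :
    GBar γ 0 * Real.exp (-(Λ * x)) ≤ GBar γ x := by
  have := GBar_le_exp_mul h hx
  rw [sub_zero] at this
  rw [Real.exp_neg, ← div_eq_mul_inv, div_le_iff₀ (Real.exp_pos _), mul_comm]
  exact this

/-- `γ(x - u)` differs from `γ(x)` by a factor between `e^{-Λ|u|}` and `e^{Λ|u|}`, both integrable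
against `φ`. With the reverse bound below, this transfers the tail assumption on `γ` to `g`. -/
lemma exists_convDensity_le_mul_slab (h : IsSlabDensity γ Λ κ) :
    ∃ K > 0, ∀ x, convDensity γ x ≤ K * γ x := by
  refine ⟨(∫ u, Real.exp (Λ * |u|) * stdPDF u) + 1, ?_, fun x => ?_⟩
  · have : 0 ≤ ∫ u, Real.exp (Λ * |u|) * stdPDF u :=
      integral_nonneg fun u => mul_nonneg (Real.exp_pos _).le (stdPDF_pos u).le
    linarith
  have : convDensity γ x ≤ (∫ u, Real.exp (Λ * |u|) * stdPDF u) * γ x := by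
    rw [convDensity, ← integral_mul_const]
    refine integral_mono (integrable_slab_mul_stdPDF h x)
      ((integrable_exp_mul_abs_stdPDF Λ).mul_const _) fun u => ?_
    have h1 := h.le_exp_mul (x - u) x
    rw [sub_sub_cancel_left, abs_neg] at h1
    calc γ (x - u) * stdPDF u ≤ _ := mul_le_mul_of_nonneg_right h1 (stdPDF_pos u).le
      _ = _ := by ring
  linarith [(h.pos x).le]

lemma exists_slab_le_mul_convDensity (h : IsSlabDensity γ Λ κ) :
    ∃ K > 0, ∀ x, γ x ≤ K * convDensity γ x := by
  set k := ∫ u, Real.exp (-Λ * |u|) * stdPDF u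
  have hpos : ∀ u, 0 < Real.exp (-Λ * |u|) * stdPDF u := fun u =>
    mul_pos (Real.exp_pos _) (stdPDF_pos u)
  have hk : 0 < k := by
    refine (integral_pos_iff_support_of_nonneg (fun u => (hpos u).le)
      (integrable_exp_mul_abs_stdPDF _)).2 ?_
    have : (Function.support fun u => Real.exp (-Λ * |u|) * stdPDF u) = univ :=
      eq_univ_of_forall fun u => (hpos u).ne'
    rw [this]; simp
  refine ⟨k⁻¹, inv_pos.2 hk, fun x => ?_⟩
  rw [inv_mul_eq_div, le_div_iff₀ hk, convDensity, mul_comm, ← integral_mul_const]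
  refine integral_mono ((integrable_exp_mul_abs_stdPDF _).mul_const _)
    (integrable_slab_mul_stdPDF h x) fun u => ?_
  have h1 := h.le_exp_mul x (x - u)
  rw [sub_sub_cancel] at h1
  have h2 : Real.exp (-Λ * |u|) * γ x ≤ γ (x - u) := by
    rw [neg_mul, Real.exp_neg, inv_mul_le_iff₀ (Real.exp_pos _)]; exact h1
  calc _ = Real.exp (-Λ * |u|) * γ x * stdPDF u := by ring
    _ ≤ _ := mul_le_mul_of_nonneg_right h2 (stdPDF_pos u).le

/-- The tail of `g` exceeds `g` by at most a linear factor. -/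
lemma exists_GBar_le (h : IsSlabDensity γ Λ κ) :
    ∃ C > 0, ∀ᶠ x in atTop, GBar γ x ≤ C * x * convDensity γ x := by
  obtain ⟨K, hK, hgK⟩ := exists_convDensity_le_mul_slab h
  obtain ⟨K', hK', hgK'⟩ := exists_slab_le_mul_convDensity h
  obtain ⟨C, hC, hb⟩ := h.tail.1.exists_pos
  refine ⟨K * C * K', by positivity, ?_⟩
  filter_upwards [hb.bound, eventually_ge_atTop 1] with x hx hx1
  have hx0 : 0 < x := by linarith
  have hI : 0 ≤ ∫ u in Ioi x, γ u := integral_nonneg fun u => (h.pos u).le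
  rw [Real.norm_of_nonneg (mul_nonneg (inv_nonneg.2 (h.pos x).le) hI),
    Real.norm_of_nonneg (by positivity), inv_mul_le_iff₀ (h.pos x)] at hx
  -- Here `κ ≤ 2` enters: the tail exponent `κ - 1` costs at most one power of `x`.
  have hpow : x ^ (κ - 1) ≤ x := by
    conv_rhs => rw [← Real.rpow_one x]
    exact Real.rpow_le_rpow_of_exponent_le hx1 (by linarith [h.kappa_mem.2])
  calc GBar γ x ≤ ∫ u in Ioi x, K * γ u :=
        setIntegral_mono_on (integrable_convDensity h).integrableOn
          (h.integrable.const_mul K).integrableOn measurableSet_Ioi fun u _ => hgK u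
    _ = K * ∫ u in Ioi x, γ u := integral_const_mul _ _
    _ ≤ K * (γ x * (C * x)) := by
        refine mul_le_mul_of_nonneg_left (hx.trans ?_) hK.le
        exact mul_le_mul_of_nonneg_left (mul_le_mul_of_nonneg_left hpow hC.le) (h.pos x).le
    _ = K * C * x * γ x := by ring
    _ ≤ K * C * x * (K' * convDensity γ x) :=
        mul_le_mul_of_nonneg_left (hgK' x) (by positivity)
    _ = _ := by ring

/-- With `v = x - u`, `γ(v) φ(x - v) / φ(x) = γ(v) e^{-v²/2} e^{xv}`. Since `g / φ` is even,
averaging the formulas at `x` and `-x` produces `cosh`, which makes monotonicity in `|x|` visible.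
-/
lemma convDensity_div_stdPDF (h : IsSlabDensity γ Λ κ) (x : ℝ) :
    (Integrable fun v => γ v * Real.exp (-(v ^ 2 / 2)) * Real.cosh (x * v)) ∧
    convDensity γ x / stdPDF x = ∫ v, γ v * Real.exp (-(v ^ 2 / 2)) * Real.cosh (x * v) := by
  have key : ∀ y : ℝ, (Integrable fun v => γ v * Real.exp (-(v ^ 2 / 2)) * Real.exp (y * v)) ∧
      convDensity γ y / stdPDF y = ∫ v, γ v * Real.exp (-(v ^ 2 / 2)) * Real.exp (y * v) := by
    intro y
    have e : (fun v => γ v * Real.exp (-(v ^ 2 / 2)) * Real.exp (y * v)) =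
        fun v => (fun u => γ (y - u) * stdPDF u / stdPDF y) (y - v) := by
      funext v
      simp only [sub_sub_cancel]
      rw [stdPDF_eq_exp_mul (y - v) y, ← mul_assoc, mul_div_assoc, div_self (stdPDF_pos y).ne',
        mul_one, mul_assoc, ← Real.exp_add]
      ring_nf
    rw [e]
    refine ⟨((integrable_slab_mul_stdPDF h y).div_const _).comp_sub_left y, ?_⟩
    rw [integral_sub_left_eq_self (fun u => γ (y - u) * stdPDF u / stdPDF y), integral_div]
    rfl
  have hc : (fun v => γ v * Real.exp (-(v ^ 2 / 2)) * Real.cosh (x * v)) =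
      fun v => (γ v * Real.exp (-(v ^ 2 / 2)) * Real.exp (x * v) +
        γ v * Real.exp (-(v ^ 2 / 2)) * Real.exp (-x * v)) / 2 := by
    funext v; rw [Real.cosh_eq, ← neg_mul]; ring
  rw [hc]
  refine ⟨((key x).1.add (key (-x)).1).div_const 2, ?_⟩
  rw [integral_div, integral_add (key x).1 (key (-x)).1, ← (key x).2, ← (key (-x)).2,
    convDensity_neg h, stdPDF_neg]
  ring

/-- The ratio `g / φ` increases with `|x|`. -/
lemma convDensity_div_stdPDF_mono (h : IsSlabDensity γ Λ κ) {x y : ℝ} (hxy : |x| ≤ |y|) :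
    convDensity γ x / stdPDF x ≤ convDensity γ y / stdPDF y := by
  obtain ⟨hx, ex⟩ := convDensity_div_stdPDF h x
  obtain ⟨hy, ey⟩ := convDensity_div_stdPDF h y
  rw [ex, ey]
  refine integral_mono hx hy fun v => mul_le_mul_of_nonneg_left ?_
    (mul_nonneg (h.pos v).le (Real.exp_pos _).le)
  rw [Real.cosh_le_cosh, abs_mul, abs_mul]
  exact mul_le_mul_of_nonneg_right hxy (abs_nonneg v)

/-- The ratio of the tails of `φ` and `g` is nonincreasing. -/
lemma PhiBar_mul_GBar_le (h : IsSlabDensity γ Λ κ) {x y : ℝ} (hx : 0 ≤ x) (hxy : x ≤ y) :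
    PhiBar y * GBar γ x ≤ PhiBar x * GBar γ y := by
  have hy : 0 ≤ y := hx.trans hxy
  have hg := integrable_convDensity h
  have hp := integrable_stdPDF
  have cross : ∀ u v : ℝ, |u| ≤ |v| →
      stdPDF v * convDensity γ u ≤ stdPDF u * convDensity γ v := by
    intro u v huv
    have := convDensity_div_stdPDF_mono h huv
    rw [div_le_div_iff₀ (stdPDF_pos u) (stdPDF_pos v)] at this
    linarith
  have sP : PhiBar x = (∫ u in Ioc x y, stdPDF u) + PhiBar y := by
    rw [PhiBar_eq_integral, PhiBar_eq_integral, ← Ioc_union_Ioi_eq_Ioi hxy,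
      setIntegral_union (Ioc_disjoint_Ioi le_rfl) measurableSet_Ioi hp.integrableOn hp.integrableOn]
  have sG : GBar γ x = (∫ u in Ioc x y, convDensity γ u) + GBar γ y := by
    rw [GBar, GBar, ← Ioc_union_Ioi_eq_Ioi hxy,
      setIntegral_union (Ioc_disjoint_Ioi le_rfl) measurableSet_Ioi hg.integrableOn hg.integrableOn]
  -- The density ratio `g / φ` is at most its value at `y` on `(x, y]` and at least that value
  -- beyond `y`. Multiplying the two integrated comparisons and cancelling `φ(y) g(y)` gives the
  -- cross inequality between `(x, y]` and the tail.
  have a1 : stdPDF y * ∫ u in Ioc x y, convDensity γ u ≤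
      convDensity γ y * ∫ u in Ioc x y, stdPDF u := by
    rw [← integral_const_mul, ← integral_const_mul]
    refine setIntegral_mono_on (hg.const_mul _).integrableOn (hp.const_mul _).integrableOn
      measurableSet_Ioc fun u hu => ?_
    have hu0 : 0 ≤ u := hx.trans hu.1.le
    rw [mul_comm (convDensity γ y)]
    exact cross u y (by rw [abs_of_nonneg hu0, abs_of_nonneg hy]; exact hu.2)
  have a2 : convDensity γ y * PhiBar y ≤ stdPDF y * GBar γ y := by
    rw [PhiBar_eq_integral, GBar, ← integral_const_mul, ← integral_const_mul]
    refine setIntegral_mono_on (hp.const_mul _).integrableOn (hg.const_mul _).integrableOn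
      measurableSet_Ioi fun u hu => ?_
    have hu' : y < u := hu
    rw [mul_comm]
    exact cross y u (by rw [abs_of_nonneg hy, abs_of_nonneg (hy.trans hu'.le)]; exact hu'.le)
  have b1 : 0 ≤ ∫ u in Ioc x y, stdPDF u := integral_nonneg fun u => (stdPDF_pos u).le
  have b2 : 0 ≤ ∫ u in Ioc x y, convDensity γ u := integral_nonneg (convDensity_nonneg h)
  rw [sP, sG]
  have p1 := mul_le_mul a1 a2 (mul_nonneg (convDensity_nonneg h y) (PhiBar_nonneg y))
    (mul_nonneg (convDensity_nonneg h y) b1)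
  have p2 : 0 < stdPDF y * convDensity γ y := mul_pos (stdPDF_pos y) (convDensity_pos h y)
  have p3 : PhiBar y * (∫ u in Ioc x y, convDensity γ u) ≤
      (∫ u in Ioc x y, stdPDF u) * GBar γ y := by
    refine le_of_mul_le_mul_left ?_ p2
    nlinarith [p1]
  nlinarith [p3]

/-! ### The inverse likelihood ratio and its excess under the null -/

/-- The likelihood ratio of the spike with respect to the mixture with slab weight `w`. -/
def invRatio (γ : ℝ → ℝ) (w x : ℝ) : ℝ := (1 + w * beta γ x)⁻¹

/-- The excess over `1` of the null expectation of `invRatio`. -/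
def excess (γ : ℝ → ℝ) (w : ℝ) : ℝ :=
  ∫ x, (w * beta γ x) ^ 2 / (1 + w * beta γ x) * stdPDF x

lemma one_add_beta (x : ℝ) : 1 + beta γ x = convDensity γ x / stdPDF x := by
  rw [beta]; ring

lemma beta_mul_stdPDF (x : ℝ) : beta γ x * stdPDF x = convDensity γ x - stdPDF x := by
  rw [beta, sub_mul, one_mul, div_mul_cancel₀ _ (stdPDF_pos x).ne']

lemma neg_one_lt_beta (h : IsSlabDensity γ Λ κ) (x : ℝ) : -1 < beta γ x := by
  have := div_pos (convDensity_pos h x) (stdPDF_pos x)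
  rw [beta]; linarith

lemma beta_abs (h : IsSlabDensity γ Λ κ) (x : ℝ) : beta γ |x| = beta γ x := by
  rcases abs_choice x with hx | hx <;> rw [hx]
  rw [beta, beta, convDensity_neg h, stdPDF_neg]

lemma measurable_beta (h : IsSlabDensity γ Λ κ) : Measurable (beta γ) :=
  ((measurable_convDensity h).div measurable_stdPDF).sub_const 1

lemma one_sub_le_one_add_mul_beta (h : IsSlabDensity γ Λ κ) {w : ℝ} (hw : 0 ≤ w) (x : ℝ) :
    1 - w ≤ 1 + w * beta γ x := by
  nlinarith [neg_one_lt_beta h x]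

lemma one_add_mul_beta_pos (h : IsSlabDensity γ Λ κ) {w : ℝ} (hw : w ∈ Icc (0 : ℝ) 1) (x : ℝ) :
    0 < 1 + w * beta γ x := by
  have := neg_one_lt_beta h x
  rcases hw.1.eq_or_lt with h0 | h0
  · rw [← h0]; norm_num
  · nlinarith [hw.2]

lemma invRatio_nonneg (h : IsSlabDensity γ Λ κ) {w : ℝ} (hw : w ∈ Icc (0 : ℝ) 1) (x : ℝ) :
    0 ≤ invRatio γ w x := inv_nonneg.2 (one_add_mul_beta_pos h hw x).le

lemma invRatio_le (h : IsSlabDensity γ Λ κ) {w : ℝ} (hw : w ∈ Icc (0 : ℝ) (1 / 2)) (x : ℝ) :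
    invRatio γ w x ≤ (1 - w)⁻¹ :=
  inv_anti₀ (by linarith [hw.2]) (one_sub_le_one_add_mul_beta h hw.1 x)

lemma invRatio_le_two (h : IsSlabDensity γ Λ κ) {w : ℝ} (hw : w ∈ Icc (0 : ℝ) (1 / 2)) (x : ℝ) :
    invRatio γ w x ≤ 2 := by
  refine (invRatio_le h hw x).trans ?_
  rw [inv_le_comm₀ (by linarith [hw.2]) (by norm_num)]
  linarith [hw.2]

lemma measurable_invRatio (h : IsSlabDensity γ Λ κ) (w : ℝ) : Measurable (invRatio γ w) :=
  (((measurable_beta h).const_mul w).const_add 1).inv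

lemma integrable_beta_mul_stdPDF (h : IsSlabDensity γ Λ κ) :
    Integrable fun x => beta γ x * stdPDF x := by
  simp_rw [beta_mul_stdPDF]
  exact (integrable_convDensity h).sub integrable_stdPDF

lemma integral_beta_mul_stdPDF (h : IsSlabDensity γ Λ κ) :
    ∫ x, beta γ x * stdPDF x = 0 := by
  simp_rw [beta_mul_stdPDF]
  rw [integral_sub (integrable_convDensity h) integrable_stdPDF, integral_convDensity h,
    integral_stdPDF, sub_self]

lemma integrable_invRatio_mul_stdPDF (h : IsSlabDensity γ Λ κ) {w : ℝ}
    (hw : w ∈ Icc (0 : ℝ) (1 / 2)) : Integrable fun x => invRatio γ w x * stdPDF x := by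
  refine Integrable.bdd_mul (c := 2) integrable_stdPDF
    (measurable_invRatio h w).aestronglyMeasurable (ae_of_all _ fun x => ?_)
  rw [Real.norm_of_nonneg (invRatio_nonneg h ⟨hw.1, by linarith [hw.2]⟩ x)]
  exact invRatio_le_two h hw x

/-- The identity `y² / (1 + y) = 1 / (1 + y) - 1 + y` with `y = w β`. As `β` has null mean zero,
integrating it identifies `excess` with the null mean of `invRatio` minus one, in a form whose
integrand is nonnegative. -/
lemma sq_div_eq_invRatio (h : IsSlabDensity γ Λ κ) {w : ℝ} (hw : w ∈ Icc (0 : ℝ) (1 / 2))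
    (x : ℝ) : (w * beta γ x) ^ 2 / (1 + w * beta γ x) * stdPDF x =
      invRatio γ w x * stdPDF x - stdPDF x + w * (beta γ x * stdPDF x) := by
  have := one_add_mul_beta_pos h ⟨hw.1, by linarith [hw.2]⟩ x
  rw [invRatio]
  field_simp
  ring

lemma integrable_excess (h : IsSlabDensity γ Λ κ) {w : ℝ} (hw : w ∈ Icc (0 : ℝ) (1 / 2)) :
    Integrable fun x => (w * beta γ x) ^ 2 / (1 + w * beta γ x) * stdPDF x := by
  simp_rw [sq_div_eq_invRatio h hw]
  exact ((integrable_invRatio_mul_stdPDF h hw).sub integrable_stdPDF).add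
    ((integrable_beta_mul_stdPDF h).const_mul w)

lemma excess_eq (h : IsSlabDensity γ Λ κ) {w : ℝ} (hw : w ∈ Icc (0 : ℝ) (1 / 2)) :
    excess γ w = (∫ x, invRatio γ w x * stdPDF x) - 1 := by
  rw [excess]
  simp_rw [sq_div_eq_invRatio h hw]
  have hi : Integrable fun x => invRatio γ w x * stdPDF x - stdPDF x :=
    (integrable_invRatio_mul_stdPDF h hw).sub integrable_stdPDF
  rw [integral_add hi ((integrable_beta_mul_stdPDF h).const_mul w), integral_sub
    (integrable_invRatio_mul_stdPDF h hw) integrable_stdPDF, integral_const_mul,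
    integral_beta_mul_stdPDF h, integral_stdPDF]
  ring

lemma integral_gaussianReal_zero_one (f : ℝ → ℝ) :
    ∫ x, f x ∂(gaussianReal 0 1) = ∫ x, f x * stdPDF x := by
  rw [integral_gaussianReal_eq_integral_smul one_ne_zero]
  simp_rw [smul_eq_mul, mul_comm (gaussianPDFReal 0 1 _)]
  rfl

lemma integral_invRatio (h : IsSlabDensity γ Λ κ) {w : ℝ} (hw : w ∈ Icc (0 : ℝ) (1 / 2)) :
    ∫ x, invRatio γ w x ∂(gaussianReal 0 1) = 1 + excess γ w := by
  rw [integral_gaussianReal_zero_one, excess_eq h hw]; ring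

lemma excess_nonneg (h : IsSlabDensity γ Λ κ) {w : ℝ} (hw : w ∈ Icc (0 : ℝ) (1 / 2)) :
    0 ≤ excess γ w :=
  integral_nonneg fun x => mul_nonneg (div_nonneg (sq_nonneg _)
    (one_add_mul_beta_pos h ⟨hw.1, by linarith [hw.2]⟩ x).le) (stdPDF_pos x).le

lemma excess_zero : excess γ 0 = 0 := by simp [excess]

/-- Follows from `invRatio ≤ 1 / (1 - w)`. Read backwards, it bounds from below the weight at which
the excess equals `s / n`. -/
lemma excess_le (h : IsSlabDensity γ Λ κ) {w : ℝ} (hw : w ∈ Icc (0 : ℝ) (1 / 2)) :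
    excess γ w ≤ w / (1 - w) := by
  have hw1 : 0 < 1 - w := by linarith [hw.2]
  have : ∫ x, invRatio γ w x * stdPDF x ≤ (1 - w)⁻¹ := by
    calc _ ≤ ∫ x, (1 - w)⁻¹ * stdPDF x :=
          integral_mono (integrable_invRatio_mul_stdPDF h hw) (integrable_stdPDF.const_mul _)
            fun x => mul_le_mul_of_nonneg_right (invRatio_le h hw x) (stdPDF_pos x).le
      _ = _ := by rw [integral_const_mul, integral_stdPDF, mul_one]
  rw [excess_eq h hw]
  have e : w / (1 - w) = (1 - w)⁻¹ - 1 := by field_simp; ring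
  linarith

/-- With `y = w β` and `r = 1 / (1 + y)`, `(r - 1)² = r · y² / (1 + y)` and `r ≤ 2`. Thus at excess
of order `s / n` the null sum has variance of order `s`, negligible against `s²`. -/
lemma integral_sq_invRatio_le (h : IsSlabDensity γ Λ κ) {w : ℝ} (hw : w ∈ Icc (0 : ℝ) (1 / 2)) :
    ∫ x, (invRatio γ w x - 1) ^ 2 ∂(gaussianReal 0 1) ≤ 2 * excess γ w := by
  rw [integral_gaussianReal_zero_one, excess, ← integral_const_mul]
  refine integral_mono_of_nonneg (ae_of_all _ fun x => mul_nonneg (sq_nonneg _) (stdPDF_pos x).le)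
    ((integrable_excess h hw).const_mul 2) (ae_of_all _ fun x => ?_)
  have hp := one_add_mul_beta_pos h ⟨hw.1, by linarith [hw.2]⟩ x
  have e : (invRatio γ w x - 1) ^ 2 =
      (w * beta γ x) ^ 2 / (1 + w * beta γ x) * invRatio γ w x := by
    rw [invRatio]; field_simp; ring
  have h2 := mul_le_mul_of_nonneg_left (invRatio_le_two h hw x)
    (div_nonneg (sq_nonneg (w * beta γ x)) hp.le)
  simp only [e]
  nlinarith [stdPDF_pos x]

lemma continuousOn_excess (h : IsSlabDensity γ Λ κ) :
    ContinuousOn (excess γ) (Icc 0 (1 / 2)) := by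
  have : ContinuousOn (fun w => (∫ x, invRatio γ w x * stdPDF x) - 1) (Icc 0 (1 / 2)) := by
    refine ContinuousOn.sub ?_ continuousOn_const
    refine continuousOn_of_dominated (bound := fun x => 2 * stdPDF x)
      (fun w _ => ((measurable_invRatio h w).mul measurable_stdPDF).aestronglyMeasurable)
      (fun w hw => ae_of_all _ fun x => ?_) (integrable_stdPDF.const_mul 2)
      (ae_of_all _ fun x => ?_)
    · rw [Real.norm_of_nonneg (mul_nonneg (invRatio_nonneg h ⟨hw.1, by linarith [hw.2]⟩ x)
        (stdPDF_pos x).le)]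
      exact mul_le_mul_of_nonneg_right (invRatio_le_two h hw x) (stdPDF_pos x).le
    · refine ContinuousOn.mul (ContinuousOn.inv₀ (by fun_prop) fun w hw => ?_) continuousOn_const
      exact (one_add_mul_beta_pos h ⟨hw.1, by linarith [hw.2]⟩ x).ne'
  exact this.congr fun w hw => excess_eq h hw

/-- Pointwise, `w b² / (1 + w b)` is nondecreasing in `w`, hence so is `excess γ w / w`. The next
lemma bounds the growth in the other direction by nearly `w²`; together they show that changing `w`
by a factor `1 ± δ` moves the excess by a definite but controlled factor. -/
lemma mul_excess_le (h : IsSlabDensity γ Λ κ) {w w' : ℝ} (hw : 0 < w) (hww' : w ≤ w')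
    (hw' : w' ≤ 1 / 2) : w' / w * excess γ w ≤ excess γ w' := by
  rw [excess, excess, ← integral_const_mul]
  refine integral_mono ((integrable_excess h ⟨hw.le, hww'.trans hw'⟩).const_mul _)
    (integrable_excess h ⟨hw.le.trans hww', hw'⟩) fun x => ?_
  have p1 := one_add_mul_beta_pos h ⟨hw.le, by linarith⟩ x
  have p2 := one_add_mul_beta_pos h ⟨hw.le.trans hww', by linarith⟩ x
  have hw'0 : 0 < w' := hw.trans_le hww'
  have key : w' / w * ((w * beta γ x) ^ 2 / (1 + w * beta γ x)) ≤
      (w' * beta γ x) ^ 2 / (1 + w' * beta γ x) := by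
    rw [div_mul_div_comm, div_le_div_iff₀ (by positivity) p2]
    have : w * (1 + w' * beta γ x) ≤ w' * (1 + w * beta γ x) := by nlinarith
    have h2 : 0 ≤ w' * w * beta γ x ^ 2 := by positivity
    nlinarith [mul_le_mul_of_nonneg_left this h2]
  calc _ = w' / w * ((w * beta γ x) ^ 2 / (1 + w * beta γ x)) * stdPDF x := by ring
    _ ≤ _ := mul_le_mul_of_nonneg_right key (stdPDF_pos x).le

/-- Comes from `1 + w' b ≥ (1 - w')(1 + w b)`, checked separately for each sign of `b > -1`. -/
lemma excess_le_mul (h : IsSlabDensity γ Λ κ) {w w' : ℝ} (hw : 0 < w) (hww' : w ≤ w')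
    (hw' : w' ≤ 1 / 2) : excess γ w' ≤ (w' / w) ^ 2 / (1 - w') * excess γ w := by
  rw [excess, excess, ← integral_const_mul]
  refine integral_mono (integrable_excess h ⟨hw.le.trans hww', hw'⟩)
    ((integrable_excess h ⟨hw.le, hww'.trans hw'⟩).const_mul _) fun x => ?_
  have p1 := one_add_mul_beta_pos h ⟨hw.le, by linarith⟩ x
  have p2 := one_add_mul_beta_pos h ⟨hw.le.trans hww', by linarith⟩ x
  have p3 : 0 < 1 - w' := by linarith
  have hb := neg_one_lt_beta h x
  have hw'0 : 0 < w' := hw.trans_le hww'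
  have key : (w' * beta γ x) ^ 2 / (1 + w' * beta γ x) ≤
      (w' / w) ^ 2 / (1 - w') * ((w * beta γ x) ^ 2 / (1 + w * beta γ x)) := by
    have e : (w' / w) ^ 2 / (1 - w') * ((w * beta γ x) ^ 2 / (1 + w * beta γ x)) =
        (w' * beta γ x) ^ 2 / ((1 - w') * (1 + w * beta γ x)) := by
      field_simp
    rw [e]
    refine div_le_div_of_nonneg_left (sq_nonneg _) (by positivity) ?_
    rcases le_total 0 (beta γ x) with h0 | h0
    · nlinarith [mul_nonneg hw.le h0, mul_nonneg hw'0.le h0]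
    · nlinarith [mul_nonneg hw.le (neg_nonneg.2 h0)]
  calc _ ≤ _ := mul_le_mul_of_nonneg_right key (stdPDF_pos x).le
    _ = _ := by ring

/-! ### The excess for small weights -/

lemma tendsto_exp_linear_sub_sq (b : ℝ) :
    Tendsto (fun x : ℝ => Real.exp (b * x - x ^ 2 / 2)) atTop (𝓝 0) := by
  refine Real.tendsto_exp_atBot.comp ?_
  have h1 : Tendsto (fun x : ℝ => -(x / 2 - b)) atTop atBot :=
    tendsto_neg_atTop_atBot.comp
      (tendsto_atTop_add_const_right _ (-b) (tendsto_id.atTop_div_const (by norm_num)))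
  refine (tendsto_id.atTop_mul_atBot₀ h1).congr fun x => ?_
  simp only [id]; ring

lemma excess_eq_two_mul (h : IsSlabDensity γ Λ κ) (w : ℝ) : excess γ w =
    2 * ∫ x in Ioi 0, (w * beta γ x) ^ 2 / (1 + w * beta γ x) * stdPDF x := by
  rw [← integral_comp_abs (f := fun x => (w * beta γ x) ^ 2 / (1 + w * beta γ x) * stdPDF x),
    excess]
  simp only [beta_abs h, stdPDF_abs]

/-- Combine `g(x) ≤ e^{Λ(ξ - x)} g(ξ)` with `(ξ² - x²) / 2 ≥ ξ (ξ - x) / 2`: to the left of `ξ` the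
function `g² / φ` decays geometrically at rate `ξ / 2 - 2 Λ`. -/
lemma sq_div_stdPDF_le (h : IsSlabDensity γ Λ κ) {x ξ : ℝ} (hx : 0 ≤ x) (hxξ : x ≤ ξ) :
    convDensity γ x ^ 2 / stdPDF x ≤ convDensity γ ξ ^ 2 / stdPDF ξ *
      (Real.exp (-(ξ / 2 - 2 * Λ) * ξ) * Real.exp ((ξ / 2 - 2 * Λ) * x)) := by
  have h1 := convDensity_le_exp_mul h x ξ
  rw [abs_sub_comm, abs_of_nonneg (sub_nonneg.2 hxξ)] at h1
  have h2 : convDensity γ x ^ 2 ≤ Real.exp (2 * (Λ * (ξ - x))) * convDensity γ ξ ^ 2 := by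
    calc _ ≤ (Real.exp (Λ * (ξ - x)) * convDensity γ ξ) ^ 2 :=
          pow_le_pow_left₀ (convDensity_nonneg h x) h1 2
      _ = _ := by rw [mul_pow, ← Real.exp_nat_mul]; norm_num
  rw [stdPDF_eq_exp_mul x ξ, ← Real.exp_add, div_le_iff₀ (mul_pos (Real.exp_pos _) (stdPDF_pos ξ))]
  refine h2.trans ?_
  have e : convDensity γ ξ ^ 2 / stdPDF ξ * Real.exp (-(ξ / 2 - 2 * Λ) * ξ + (ξ / 2 - 2 * Λ) * x) *
      (Real.exp ((ξ ^ 2 - x ^ 2) / 2) * stdPDF ξ) =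
      Real.exp (-(ξ / 2 - 2 * Λ) * ξ + (ξ / 2 - 2 * Λ) * x + (ξ ^ 2 - x ^ 2) / 2) *
        convDensity γ ξ ^ 2 := by
    rw [Real.exp_add _ ((ξ ^ 2 - x ^ 2) / 2)]
    have := (stdPDF_pos ξ).ne'
    field_simp
  rw [e]
  refine mul_le_mul_of_nonneg_right (Real.exp_le_exp.2 ?_) (sq_nonneg _)
  nlinarith [mul_nonneg hx (sub_nonneg.2 hxξ)]

/-- The integral is cut at `ξ`. The three terms are the tail of `w g`, the constant contribution of
the region where `β` is bounded, and the geometric sum of `w² g² / φ` below `ξ`. -/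
lemma half_excess_le (h : IsSlabDensity γ Λ κ) {w ξ : ℝ} (hw : w ∈ Icc (0 : ℝ) (1 / 2))
    (hξ : 0 < ξ) (hΛ : 0 < ξ / 2 - 2 * Λ) :
    ∫ x in Ioi 0, (w * beta γ x) ^ 2 / (1 + w * beta γ x) * stdPDF x ≤
      w * GBar γ ξ + 2 * w ^ 2 +
        2 * w ^ 2 * (convDensity γ ξ ^ 2 / stdPDF ξ / (ξ / 2 - 2 * Λ)) := by
  set a := ξ / 2 - 2 * Λ with ha
  set A := convDensity γ ξ ^ 2 / stdPDF ξ with hA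
  have hA0 : 0 ≤ A := div_nonneg (sq_nonneg _) (stdPDF_pos ξ).le
  have hF := (integrable_excess h hw)
  have hpos : ∀ x, 0 < 1 + w * beta γ x := one_add_mul_beta_pos h ⟨hw.1, by linarith [hw.2]⟩
  have hle2 : ∀ x, (1 + w * beta γ x)⁻¹ ≤ 2 := invRatio_le_two h hw
  have hexp : IntegrableOn (fun x => Real.exp (-a * ξ) * Real.exp (a * x)) (Iic ξ) :=
    (integrableOn_exp_mul_Iic hΛ ξ).const_mul _
  have crude : ∀ x, (w * beta γ x) ^ 2 / (1 + w * beta γ x) ≤ 2 * w ^ 2 * beta γ x ^ 2 := by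
    intro x
    rw [div_eq_mul_inv, mul_pow]
    nlinarith [mul_le_mul_of_nonneg_left (hle2 x)
      (mul_nonneg (sq_nonneg w) (sq_nonneg (beta γ x)))]
  rw [← Ioc_union_Ioi_eq_Ioi hξ.le, setIntegral_union (Ioc_disjoint_Ioi le_rfl) measurableSet_Ioi
    hF.integrableOn hF.integrableOn]
  have low : ∫ x in Ioc 0 ξ, (w * beta γ x) ^ 2 / (1 + w * beta γ x) * stdPDF x ≤
      2 * w ^ 2 * (A / a) + ∫ x in Ioc 0 ξ, 2 * w ^ 2 * stdPDF x := by
    have hbd : ∫ x in Ioc 0 ξ, 2 * w ^ 2 * (A * (Real.exp (-a * ξ) * Real.exp (a * x))) ≤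
        2 * w ^ 2 * (A / a) := by
      rw [integral_const_mul, integral_const_mul, div_eq_mul_inv]
      refine mul_le_mul_of_nonneg_left (mul_le_mul_of_nonneg_left ?_ hA0) (by positivity)
      calc ∫ x in Ioc 0 ξ, Real.exp (-a * ξ) * Real.exp (a * x)
          ≤ ∫ x in Iic ξ, Real.exp (-a * ξ) * Real.exp (a * x) :=
            setIntegral_mono_set hexp (ae_of_all _ fun x => by positivity)
              (Ioc_subset_Iic_self.eventuallyLE)
        _ = a⁻¹ := by
            rw [integral_const_mul, integral_exp_mul_Iic hΛ, mul_div_assoc', ← Real.exp_add]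
            simp
    refine le_trans ?_ (add_le_add_left hbd _)
    have hi1 : IntegrableOn (fun x => 2 * w ^ 2 * (A * (Real.exp (-a * ξ) * Real.exp (a * x))))
        (Ioc 0 ξ) := ((hexp.mono_set Ioc_subset_Iic_self).const_mul A).const_mul _
    have hi2 : IntegrableOn (fun x => 2 * w ^ 2 * stdPDF x) (Ioc 0 ξ) :=
      (integrable_stdPDF.const_mul _).integrableOn
    rw [← integral_add hi1 hi2]
    refine setIntegral_mono_on hF.integrableOn (hi1.add hi2) measurableSet_Ioc fun x hx => ?_
    have h1 := mul_le_mul_of_nonneg_right (crude x) (stdPDF_pos x).le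
    -- Uses `b² ≤ (1 + b)² + 1` for `b > -1`, and `(1 + β)² φ = g² / φ`.
    have h2 : beta γ x ^ 2 * stdPDF x ≤ convDensity γ x ^ 2 / stdPDF x + stdPDF x := by
      have e : convDensity γ x ^ 2 / stdPDF x = (1 + beta γ x) ^ 2 * stdPDF x := by
        rw [one_add_beta]; have := (stdPDF_pos x).ne'; field_simp
      rw [e]
      nlinarith [stdPDF_pos x, neg_one_lt_beta h x]
    have h3 := sq_div_stdPDF_le h hx.1.le hx.2
    have h4 := mul_le_mul_of_nonneg_left (h2.trans (add_le_add_left h3 _))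
      (by positivity : 0 ≤ 2 * w ^ 2)
    calc _ ≤ _ := h1
      _ = 2 * w ^ 2 * (beta γ x ^ 2 * stdPDF x) := by ring
      _ ≤ _ := h4
      _ = _ := by rw [← hA, ← ha]; ring
  have high : ∫ x in Ioi ξ, (w * beta γ x) ^ 2 / (1 + w * beta γ x) * stdPDF x ≤
      w * GBar γ ξ + ∫ x in Ioi ξ, 2 * w ^ 2 * stdPDF x := by
    have hi1 : IntegrableOn (fun x => w * convDensity γ x) (Ioi ξ) :=
      ((integrable_convDensity h).const_mul w).integrableOn
    have hi2 : IntegrableOn (fun x => 2 * w ^ 2 * stdPDF x) (Ioi ξ) :=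
      (integrable_stdPDF.const_mul _).integrableOn
    rw [GBar, ← integral_const_mul, ← integral_add hi1 hi2]
    refine setIntegral_mono_on hF.integrableOn (hi1.add hi2) measurableSet_Ioi fun x _ => ?_
    have e : convDensity γ x = (1 + beta γ x) * stdPDF x := by
      rw [one_add_beta, div_mul_cancel₀ _ (stdPDF_pos x).ne']
    have hb := neg_one_lt_beta h x
    -- For `β ≥ 0`, `y² / (1 + y) ≤ y`; for `β < 0`, `β² ≤ 1` and the term `2 w²` suffices.
    have key : (w * beta γ x) ^ 2 / (1 + w * beta γ x) ≤ w * (1 + beta γ x) + 2 * w ^ 2 := by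
      rcases le_total 0 (beta γ x) with h0 | h0
      · rw [div_le_iff₀ (hpos x)]
        have := mul_nonneg hw.1 h0
        nlinarith [hw.1, mul_nonneg hw.1 hw.1, mul_nonneg (mul_nonneg hw.1 hw.1) this]
      · have h1 : beta γ x ^ 2 ≤ 1 := by nlinarith
        nlinarith [crude x, mul_le_mul_of_nonneg_left h1 (sq_nonneg w),
          mul_nonneg hw.1 (by linarith : 0 ≤ 1 + beta γ x)]
    calc _ ≤ _ := mul_le_mul_of_nonneg_right key (stdPDF_pos x).le
      _ = _ := by rw [e]; ring
  have tot : (∫ x in Ioc 0 ξ, 2 * w ^ 2 * stdPDF x) + ∫ x in Ioi ξ, 2 * w ^ 2 * stdPDF x ≤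
      2 * w ^ 2 := by
    have hi := (integrable_stdPDF.const_mul (2 * w ^ 2))
    rw [← setIntegral_union (Ioc_disjoint_Ioi le_rfl) measurableSet_Ioi
      hi.integrableOn hi.integrableOn]
    calc _ ≤ ∫ x, 2 * w ^ 2 * stdPDF x :=
          setIntegral_le_integral hi (ae_of_all _ fun x => by have := stdPDF_pos x; positivity)
      _ = _ := by rw [integral_const_mul, integral_stdPDF, mul_one]
  linarith

/-- Upper half of the equivalence between the excess and `2 w Ḡ(ξ)`. -/
lemma eventually_half_excess_le (h : IsSlabDensity γ Λ κ) {c η : ℝ} (hc : 0 < c) (hη : 0 < η) :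
    ∀ᶠ ξ in atTop, ∀ w ∈ Icc (0 : ℝ) (1 / 2), (1 - w) * PhiBar ξ = c * w * GBar γ ξ →
      ∫ x in Ioi 0, (w * beta γ x) ^ 2 / (1 + w * beta γ x) * stdPDF x ≤
        (1 + η) * (w * GBar γ ξ) := by
  have t1 := (tendsto_exp_linear_sub_sq (2 * Λ)).const_mul (2 / (c * GBar γ 0 ^ 2))
  rw [mul_zero] at t1
  have t2 : Tendsto (fun ξ : ℝ => 2 * Real.exp (2 * Λ) / c / (ξ / 2 - 2 * Λ)) atTop (𝓝 0) :=
    tendsto_const_nhds.div_atTop (tendsto_atTop_add_const_right _ (-(2 * Λ))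
      (tendsto_id.atTop_div_const (by norm_num)))
  filter_upwards [t1.eventually_le_const (half_pos hη), t2.eventually_le_const (half_pos hη),
    eventually_gt_atTop (4 * Λ), eventually_ge_atTop 1] with ξ e1 e2 e3 e4 w hw hrel
  have hΛ : 0 < ξ / 2 - 2 * Λ := by linarith
  have hG := GBar_pos h ξ
  have hG0 := GBar_pos h 0
  have hφ := stdPDF_pos ξ
  refine (half_excess_le h hw (by linarith) hΛ).trans ?_
  have hwle : c * w * GBar γ ξ ≤ stdPDF ξ := by
    rw [← hrel]
    calc (1 - w) * PhiBar ξ ≤ 1 * PhiBar ξ :=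
          mul_le_mul_of_nonneg_right (by linarith [hw.1]) (PhiBar_nonneg _)
      _ ≤ stdPDF ξ := by rw [one_mul]; exact PhiBar_le_stdPDF e4
  -- The threshold equation gives `w Ḡ(ξ) ≲ e^{-ξ²/2}`, which is negligible against `Ḡ(ξ)² ≳
  -- e^{-2Λξ}`; hence `w` is negligible against `Ḡ(ξ)`.
  have b1 : 2 * w ≤ η / 2 * GBar γ ξ := by
    have hlow := GBar_zero_le h (by linarith : (0 : ℝ) ≤ ξ)
    have k1 : c * w * GBar γ ξ ≤ Real.exp (-(ξ ^ 2 / 2)) := by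
      have := stdPDF_le_exp ξ; have := Real.exp_pos (-(ξ ^ 2 / 2)); linarith
    have k2 : Real.exp (-(ξ ^ 2 / 2)) * 2 / c ≤ η / 2 * (GBar γ 0 * Real.exp (-(Λ * ξ))) ^ 2 := by
      have e : Real.exp (-(ξ ^ 2 / 2)) * 2 / c = 2 / (c * GBar γ 0 ^ 2) *
          Real.exp (2 * Λ * ξ - ξ ^ 2 / 2) * (GBar γ 0 * Real.exp (-(Λ * ξ))) ^ 2 := by
        rw [mul_pow, ← Real.exp_nat_mul]
        have : Real.exp (-(ξ ^ 2 / 2)) =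
            Real.exp (2 * Λ * ξ - ξ ^ 2 / 2) * Real.exp (((2 : ℕ) : ℝ) * -(Λ * ξ)) := by
          rw [← Real.exp_add]; congr 1; push_cast; ring
        rw [this]; field_simp
      rw [e]
      exact mul_le_mul_of_nonneg_right e1 (sq_nonneg _)
    have k3 : (GBar γ 0 * Real.exp (-(Λ * ξ))) ^ 2 ≤ GBar γ ξ ^ 2 :=
      pow_le_pow_left₀ (by positivity) hlow 2
    have k4 : 2 * w * GBar γ ξ ≤ η / 2 * GBar γ ξ ^ 2 := by
      calc 2 * w * GBar γ ξ = c * w * GBar γ ξ * 2 / c := by field_simp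
        _ ≤ Real.exp (-(ξ ^ 2 / 2)) * 2 / c := by gcongr
        _ ≤ _ := k2.trans (mul_le_mul_of_nonneg_left k3 (by linarith))
    refine le_of_mul_le_mul_right ?_ hG
    linarith [k4]
  -- Here `g ≤ e^Λ Ḡ` and `w Ḡ ≤ φ / c` at `ξ`, so the geometric sum is smaller than `Ḡ(ξ)` by a
  -- factor of order `1 / ξ`.
  have b2 : 2 * w * (convDensity γ ξ ^ 2 / stdPDF ξ / (ξ / 2 - 2 * Λ)) ≤ η / 2 * GBar γ ξ := by
    have k1 : convDensity γ ξ ^ 2 ≤ Real.exp (2 * Λ) * GBar γ ξ ^ 2 := by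
      calc _ ≤ (Real.exp Λ * GBar γ ξ) ^ 2 :=
            pow_le_pow_left₀ (convDensity_nonneg h ξ) (convDensity_le_GBar h ξ) 2
        _ = _ := by rw [mul_pow, ← Real.exp_nat_mul]; norm_num
    have hw' : w ≤ stdPDF ξ / (c * GBar γ ξ) := by
      rw [le_div_iff₀ (by positivity)]; linarith
    calc 2 * w * (convDensity γ ξ ^ 2 / stdPDF ξ / (ξ / 2 - 2 * Λ))
        ≤ 2 * (stdPDF ξ / (c * GBar γ ξ)) *
          (Real.exp (2 * Λ) * GBar γ ξ ^ 2 / stdPDF ξ / (ξ / 2 - 2 * Λ)) := by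
          have := hw.1
          gcongr
      _ = 2 * Real.exp (2 * Λ) / c / (ξ / 2 - 2 * Λ) * GBar γ ξ := by field_simp
      _ ≤ _ := mul_le_mul_of_nonneg_right e2 hG.le
  nlinarith [mul_le_mul_of_nonneg_left b1 hw.1, mul_le_mul_of_nonneg_left b2 hw.1]

/-- Slightly above the threshold the weighted ratio `w β` is large. -/
lemma eventually_le_mul_beta (h : IsSlabDensity γ Λ κ) {c ε : ℝ} (hc : 0 < c) (hε : 0 < ε)
    (K : ℝ) :
    ∀ᶠ ξ in atTop, ∀ w ∈ Icc (0 : ℝ) (1 / 2), (1 - w) * PhiBar ξ = c * w * GBar γ ξ →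
      ∀ x, ξ + ε ≤ |x| → K ≤ w * beta γ x := by
  obtain ⟨C, hC, hGC⟩ := exists_GBar_le h
  have t1 : Tendsto (fun ξ : ℝ => (ε / 2) * Real.exp (-(Λ * ε)) / (2 * c * C) * (ε / 2) *
      (Real.exp (ξ * ε / 2) / (ξ * ε / 2) ^ 1)) atTop atTop := by
    refine Tendsto.const_mul_atTop (by positivity) ?_
    exact (Real.tendsto_exp_div_pow_atTop 1).comp
      ((tendsto_id.atTop_mul_const hε).atTop_div_const (by norm_num))
  filter_upwards [t1.eventually_ge_atTop (K + 1), hGC, eventually_ge_atTop 1]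
    with ξ e1 e2 e3 w hw hrel x hx
  have hξ0 : 0 < ξ := by linarith
  have hG := GBar_pos h ξ
  have hg := convDensity_pos h ξ
  have habs : |ξ + ε| ≤ |x| := by rwa [abs_of_pos (by linarith)]
  have hmono := convDensity_div_stdPDF_mono h habs
  have hP := mul_stdPDF_le_PhiBar hξ0.le (half_pos hε).le
  have hwlow : ε / 2 * stdPDF (ξ + ε / 2) / (2 * c * GBar γ ξ) ≤ w := by
    rw [div_le_iff₀ (by positivity)]
    have : 1 / 2 * PhiBar ξ ≤ (1 - w) * PhiBar ξ :=
      mul_le_mul_of_nonneg_right (by linarith [hw.2]) (PhiBar_nonneg _)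
    nlinarith
  have hglow : Real.exp (-(Λ * ε)) * convDensity γ ξ ≤ convDensity γ (ξ + ε) := by
    have := convDensity_le_exp_mul h ξ (ξ + ε)
    rw [sub_add_cancel_left, abs_neg, abs_of_pos hε] at this
    rw [Real.exp_neg, inv_mul_le_iff₀ (Real.exp_pos _)]
    exact this
  -- Moving from `ξ + ε / 2` to `ξ + ε` gains `e^{ξε/2}`, which beats the linear factor lost in
  -- `Ḡ(ξ) ≤ C ξ g(ξ)`.
  have hφ : Real.exp (ξ * ε / 2) * stdPDF (ξ + ε) ≤ stdPDF (ξ + ε / 2) := by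
    rw [stdPDF_eq_exp_mul (ξ + ε / 2) (ξ + ε)]
    refine mul_le_mul_of_nonneg_right (Real.exp_le_exp.2 ?_) (stdPDF_pos _).le
    nlinarith [mul_pos hε hε, mul_pos hξ0 hε]
  have main : K + 1 ≤ w * (convDensity γ (ξ + ε) / stdPDF (ξ + ε)) := by
    refine e1.trans ?_
    have hφε := stdPDF_pos (ξ + ε)
    calc (ε / 2) * Real.exp (-(Λ * ε)) / (2 * c * C) * (ε / 2) *
          (Real.exp (ξ * ε / 2) / (ξ * ε / 2) ^ 1)
        = ε / 2 * (Real.exp (ξ * ε / 2) * stdPDF (ξ + ε)) /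
            (2 * c * (C * ξ * convDensity γ ξ)) *
          (Real.exp (-(Λ * ε)) * convDensity γ ξ / stdPDF (ξ + ε)) := by
          field_simp
      _ ≤ ε / 2 * stdPDF (ξ + ε / 2) / (2 * c * GBar γ ξ) *
          (convDensity γ (ξ + ε) / stdPDF (ξ + ε)) := by
          have := stdPDF_pos (ξ + ε / 2)
          gcongr
      _ ≤ _ := mul_le_mul_of_nonneg_right hwlow
          (div_pos (convDensity_pos h _) (stdPDF_pos _)).le
  have : w * (1 + beta γ x) ≥ K + 1 := by
    rw [one_add_beta]
    exact main.trans (mul_le_mul_of_nonneg_left hmono hw.1)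
  nlinarith [hw.2]

/-- Lower half of the equivalence between the excess and `2 w Ḡ(ξ)`. -/
lemma eventually_le_half_excess (h : IsSlabDensity γ Λ κ) {c η : ℝ} (hc : 0 < c) (hη : 0 < η)
    (hη1 : η ≤ 1) :
    ∀ᶠ ξ in atTop, ∀ w ∈ Icc (0 : ℝ) (1 / 2), (1 - w) * PhiBar ξ = c * w * GBar γ ξ →
      (1 - η) * (w * GBar γ ξ) ≤
        ∫ x in Ioi 0, (w * beta γ x) ^ 2 / (1 + w * beta γ x) * stdPDF x := by
  have hΛ := h.lipschitz_const_nonneg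
  -- Chosen so that `Λ ε ≤ η / 4`: moving the cut from `ξ` to `ξ + ε` costs at most a factor `1 - η
  -- / 4` in `Ḡ`. The bound `w β ≥ 8 / η` beyond it costs another such factor.
  set ε := η / (4 * (Λ + 1)) with hε_def
  have hε : 0 < ε := by positivity
  have hΛε : Λ * ε ≤ η / 4 := by
    rw [hε_def, mul_div_assoc', div_le_div_iff₀ (by positivity) (by norm_num)]
    nlinarith
  filter_upwards [eventually_le_mul_beta h hc hε (8 / η), eventually_ge_atTop 0]
    with ξ hK hξ w hw hrel
  have hF := integrable_excess h hw
  have hg := integrable_convDensity h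
  have hFpos : ∀ x, 0 ≤ (w * beta γ x) ^ 2 / (1 + w * beta γ x) * stdPDF x := fun x =>
    mul_nonneg (div_nonneg (sq_nonneg _)
      (one_add_mul_beta_pos h ⟨hw.1, by linarith [hw.2]⟩ x).le) (stdPDF_pos x).le
  have hwG : 0 ≤ w * GBar γ ξ := mul_nonneg hw.1 (GBar_pos h ξ).le
  have hexp : 1 - η / 4 ≤ Real.exp (-(Λ * ε)) := by
    have := Real.add_one_le_exp (-(Λ * ε)); linarith
  have hGs : Real.exp (-(Λ * ε)) * GBar γ ξ ≤ GBar γ (ξ + ε) := by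
    have := GBar_le_exp_mul h (le_add_of_nonneg_right hε.le : ξ ≤ ξ + ε)
    rw [add_sub_cancel_left] at this
    rw [Real.exp_neg, inv_mul_le_iff₀ (Real.exp_pos _)]
    exact this
  have hpt : ∀ x ∈ Ioi (ξ + ε), (1 - η / 4) * w * convDensity γ x ≤
      (w * beta γ x) ^ 2 / (1 + w * beta γ x) * stdPDF x := by
    intro x hx
    have hx' : ξ + ε ≤ |x| := le_trans (le_of_lt hx) (le_abs_self x)
    have hy := hK w hw hrel x hx'
    set y := w * beta γ x with hy_def
    have e : convDensity γ x = (1 + beta γ x) * stdPDF x := by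
      rw [one_add_beta, div_mul_cancel₀ _ (stdPDF_pos x).ne']
    have hy8 : 8 ≤ y * η := by rwa [div_le_iff₀ hη] at hy
    have hy0 : 0 < y := lt_of_lt_of_le (by positivity) hy
    have key : (1 - η / 4) * (w + y) ≤ y ^ 2 / (1 + y) := by
      rw [le_div_iff₀ (by linarith)]
      have hw1 : w + y ≤ 1 + y := by linarith [hw.2]
      calc (1 - η / 4) * (w + y) * (1 + y) ≤ (1 - η / 4) * (1 + y) * (1 + y) := by
            gcongr; linarith
        _ ≤ y ^ 2 := by nlinarith
    calc _ = (1 - η / 4) * (w + y) * stdPDF x := by rw [e, hy_def]; ring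
      _ ≤ _ := mul_le_mul_of_nonneg_right key (stdPDF_pos x).le
  calc (1 - η) * (w * GBar γ ξ) ≤ (1 - η / 4) * (1 - η / 4) * (w * GBar γ ξ) := by
        refine mul_le_mul_of_nonneg_right ?_ hwG; nlinarith
    _ ≤ (1 - η / 4) * Real.exp (-(Λ * ε)) * (w * GBar γ ξ) := by
        refine mul_le_mul_of_nonneg_right (mul_le_mul_of_nonneg_left hexp (by linarith)) hwG
    _ = (1 - η / 4) * w * (Real.exp (-(Λ * ε)) * GBar γ ξ) := by ring
    _ ≤ (1 - η / 4) * w * GBar γ (ξ + ε) :=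
        mul_le_mul_of_nonneg_left hGs (mul_nonneg (by linarith) hw.1)
    _ = ∫ x in Ioi (ξ + ε), (1 - η / 4) * w * convDensity γ x := (integral_const_mul _ _).symm
    _ ≤ ∫ x in Ioi (ξ + ε), (w * beta γ x) ^ 2 / (1 + w * beta γ x) * stdPDF x :=
        setIntegral_mono_on (hg.const_mul _).integrableOn hF.integrableOn measurableSet_Ioi hpt
    _ ≤ _ := setIntegral_mono_set hF.integrableOn (ae_of_all _ hFpos)
        (Ioi_subset_Ioi (by linarith)).eventuallyLE

/-! ### Thresholds of the `q`-value -/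

lemma qValue_le_iff (h : IsSlabDensity γ Λ κ) {w t : ℝ} (hw : w ∈ Ioc (0 : ℝ) 1) (ht : t < 1)
    (x : ℝ) : qValue γ w x ≤ t ↔
      (1 - w) * PhiBar |x| ≤ t / (1 - t) * w * GBar γ |x| := by
  have ht1 : 0 < 1 - t := by linarith
  have hD : 0 < (1 - w) * PhiBar |x| + w * GBar γ |x| :=
    add_pos_of_nonneg_of_pos (mul_nonneg (by linarith [hw.2]) (PhiBar_nonneg _))
      (mul_pos hw.1 (GBar_pos h _))
  rw [qValue_eq h ⟨hw.1.le, hw.2⟩, div_le_iff₀ hD, mul_assoc (t / (1 - t)), div_mul_eq_mul_div,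
    le_div_iff₀ ht1]
  constructor <;> intro h1 <;> nlinarith

lemma eventually_PhiBar_le (h : IsSlabDensity γ Λ κ) {c : ℝ} (hc : 0 < c) :
    ∀ᶠ x in atTop, PhiBar x ≤ c * GBar γ x := by
  have hG0 := GBar_pos h 0
  filter_upwards [(tendsto_exp_linear_sub_sq Λ).eventually_le_const (mul_pos hc hG0),
    eventually_ge_atTop 1] with x hx hx1
  have h1 : PhiBar x ≤ Real.exp (-(x ^ 2 / 2)) := by
    have := two_mul_PhiBar_le_exp hx1
    have := PhiBar_nonneg x
    linarith
  calc PhiBar x ≤ Real.exp (-(x ^ 2 / 2)) := h1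
    _ = Real.exp (Λ * x - x ^ 2 / 2) * Real.exp (-(Λ * x)) := by
        rw [← Real.exp_add]; congr 1; ring
    _ ≤ c * GBar γ 0 * Real.exp (-(Λ * x)) :=
        mul_le_mul_of_nonneg_right hx (Real.exp_pos _).le
    _ ≤ c * GBar γ x := by
        rw [mul_assoc]
        exact mul_le_mul_of_nonneg_left (GBar_zero_le h (by linarith)) hc.le

/-- The rejection region on `[0, ∞)` is closed, upward closed because `Φ̄ / Ḡ` is nonincreasing, and
nonempty because `Ḡ` has the heavier tail; `ξ` is its infimum. Strict failure at `M` puts `ξ` to the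
right of `M`, and continuity from the left forces equality at `ξ`. -/
lemma exists_threshold (h : IsSlabDensity γ Λ κ) {t : ℝ} (ht : t ∈ Ioo (0 : ℝ) 1) {w M : ℝ}
    (hw : w ∈ Ioc (0 : ℝ) (1 / 2)) (hM : 0 ≤ M)
    (hwM : t / (1 - t) * w * GBar γ M < (1 - w) * PhiBar M) :
    ∃ ξ > M, (1 - w) * PhiBar ξ = t / (1 - t) * w * GBar γ ξ ∧
      ∀ x, qValue γ w x ≤ t ↔ ξ ≤ |x| := by
  set c := t / (1 - t) with hc_def
  have hc : 0 < c := div_pos ht.1 (by linarith [ht.2])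
  have hw1 : 0 < 1 - w := by linarith [hw.2]
  set f : ℝ → ℝ := fun x => c * w * GBar γ x - (1 - w) * PhiBar x with hf_def
  have hf : Continuous f := ((continuous_GBar h).const_mul _).sub (continuous_PhiBar.const_mul _)
  set A : Set ℝ := Ici 0 ∩ f ⁻¹' Ici 0 with hA_def
  have hAc : IsClosed A := isClosed_Ici.inter (isClosed_Ici.preimage hf)
  have hAb : BddBelow A := ⟨0, fun x hx => hx.1⟩
  have hup : ∀ x ∈ A, ∀ y, x ≤ y → y ∈ A := by
    rintro x ⟨hx0, hx⟩ y hxy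
    have hx0' : (0 : ℝ) ≤ x := hx0
    have hx' : 0 ≤ c * w * GBar γ x - (1 - w) * PhiBar x := hx
    refine ⟨hx0'.trans hxy, ?_⟩
    change 0 ≤ c * w * GBar γ y - (1 - w) * PhiBar y
    have h1 := PhiBar_mul_GBar_le h hx0' hxy
    have hGx := GBar_pos h x
    have hGy := GBar_pos h y
    have h2 : (1 - w) * PhiBar y * GBar γ x ≤ c * w * GBar γ y * GBar γ x := by
      nlinarith
    linarith [le_of_mul_le_mul_right h2 hGx]
  have hAne : A.Nonempty := by
    obtain ⟨x, hx, hx0⟩ := ((eventually_PhiBar_le h (mul_pos hc hw.1)).and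
      (eventually_ge_atTop 0)).exists
    refine ⟨x, hx0, ?_⟩
    change 0 ≤ c * w * GBar γ x - (1 - w) * PhiBar x
    have := PhiBar_nonneg x
    nlinarith [hw.1]
  have hmem : sInf A ∈ A := hAc.csInf_mem hAne hAb
  have hMA : M < sInf A := by
    by_contra hcon
    have : 0 ≤ f M := (hup _ hmem M (not_lt.1 hcon)).2
    simp only [hf_def] at this
    linarith
  refine ⟨sInf A, hMA, ?_, fun x => ?_⟩
  · have h1 : 0 ≤ f (sInf A) := hmem.2
    have h2 : f (sInf A) ≤ 0 := by
      have hsub : Ioo M (sInf A) ⊆ f ⁻¹' Iic 0 := by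
        intro y hy
        by_contra hcon
        have hy0 : 0 < f y := not_le.1 hcon
        have : y ∈ A := ⟨hM.trans hy.1.le, hy0.le⟩
        exact absurd (csInf_le hAb this) (not_le.2 hy.2)
      have := closure_minimal hsub (isClosed_Iic.preimage hf)
      rw [closure_Ioo hMA.ne] at this
      exact this (right_mem_Icc.2 hMA.le)
    simp only [hf_def] at h1 h2
    linarith
  · rw [qValue_le_iff h ⟨hw.1, by linarith [hw.2]⟩ ht.2]
    have : (1 - w) * PhiBar |x| ≤ c * w * GBar γ |x| ↔ |x| ∈ A := by
      constructor
      · intro hx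
        refine ⟨abs_nonneg x, ?_⟩
        change 0 ≤ c * w * GBar γ |x| - (1 - w) * PhiBar |x|
        linarith
      · rintro ⟨-, hx⟩
        have hx' : 0 ≤ c * w * GBar γ |x| - (1 - w) * PhiBar |x| := hx
        linarith
    rw [this]
    exact ⟨fun hx => csInf_le hAb hx, fun hx => hup _ hmem _ hx⟩

/-- For small slab weights, the threshold of the `q`-value has a null probability comparable to
the excess, and observations beyond it have a small inverse likelihood ratio. -/
theorem exists_weight_threshold (h : IsSlabDensity γ Λ κ) {t : ℝ} (ht : t ∈ Ioo (0 : ℝ) 1)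
    {δ : ℝ} (hδ : 0 < δ) (hδ1 : δ ≤ 1) :
    ∃ w₀ ∈ Ioo (0 : ℝ) (1 / 2), ∀ w ∈ Ioc 0 w₀, ∃ ξ : ℝ, 1 ≤ ξ ∧
      (∀ x, qValue γ w x ≤ t ↔ ξ ≤ |x|) ∧
      (1 - δ) * (t / (1 - t) * excess γ w) ≤ 2 * PhiBar ξ ∧
      2 * PhiBar ξ ≤ (1 + δ) * (t / (1 - t) * excess γ w) ∧
      ∀ x, ξ + 1 ≤ |x| → invRatio γ w x ≤ δ := by
  set c := t / (1 - t) with hc_def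
  have hc : 0 < c := div_pos ht.1 (by linarith [ht.2])
  obtain ⟨M, hM⟩ := eventually_atTop.1
    ((eventually_half_excess_le h hc (by positivity : 0 < δ / 4)).and
      ((eventually_le_half_excess h hc (by positivity : 0 < δ / 4) (by linarith)).and
        (eventually_le_mul_beta h hc one_pos δ⁻¹)))
  set M' := max M 1
  have hM'0 : 0 ≤ M' := zero_le_one.trans (le_max_right _ _)
  have hP := PhiBar_pos hM'0
  have hG := GBar_pos h M'
  -- The first two bounds let factors `1 - w` be absorbed into `δ`. The third makes `M'` fail the
  -- rejection criterion, so `ξ > M'` and the estimates for large `ξ` apply.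
  refine ⟨min (δ / 8) (min (1 / 4) (PhiBar M' / (4 * c * GBar γ M'))), ⟨by positivity, ?_⟩,
    fun w hw => ?_⟩
  · exact ((min_le_right _ _).trans (min_le_left _ _)).trans_lt (by norm_num)
  have hw1 : w ≤ δ / 8 := hw.2.trans (min_le_left _ _)
  have hw2 : w ≤ 1 / 4 := hw.2.trans ((min_le_right _ _).trans (min_le_left _ _))
  have hw3 : w * (4 * c * GBar γ M') ≤ PhiBar M' := by
    rw [← le_div_iff₀ (by positivity)]
    exact hw.2.trans ((min_le_right _ _).trans (min_le_right _ _))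
  obtain ⟨ξ, hξM, hrel, hiff⟩ := exists_threshold (w := w) h ht ⟨hw.1, by linarith⟩ hM'0
    (by nlinarith [hw.1])
  have hξ1 : 1 ≤ ξ := (le_max_right M 1).trans hξM.le
  obtain ⟨hu, hl, hb⟩ := hM ξ ((le_max_left M 1).trans hξM.le)
  have hw' : w ∈ Icc (0 : ℝ) (1 / 2) := ⟨hw.1.le, by linarith⟩
  specialize hu w hw' hrel
  specialize hl w hw' hrel
  specialize hb w hw' hrel
  have hH := excess_eq_two_mul h w
  set D := ∫ x in Ioi 0, (w * beta γ x) ^ 2 / (1 + w * beta γ x) * stdPDF x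
  have hPξ := PhiBar_nonneg ξ
  have hwG : 0 < w * GBar γ ξ := mul_pos hw.1 (GBar_pos h ξ)
  have hrel' : (1 - w) * PhiBar ξ = c * (w * GBar γ ξ) := by rw [hrel]; ring
  refine ⟨ξ, hξ1, hiff, ?_, ?_, fun x hx => ?_⟩
  · rw [hH]
    have h1 : (1 - δ) * D ≤ w * GBar γ ξ := by
      have := mul_le_mul_of_nonneg_left hu (by linarith : 0 ≤ 1 - δ)
      nlinarith
    have h2 := mul_le_mul_of_nonneg_left h1 hc.le
    nlinarith [hw.1]
  · rw [hH]
    have h1 : w * GBar γ ξ ≤ (1 - w) * ((1 + δ) * D) := by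
      have h3 : 1 ≤ (1 - w) * (1 + δ) * (1 - δ / 4) := by
        have h6 : (1 - δ / 8) * ((1 + δ) * (1 - δ / 4)) ≤ (1 - w) * ((1 + δ) * (1 - δ / 4)) :=
          mul_le_mul_of_nonneg_right (by linarith)
            (mul_nonneg (by linarith) (by linarith))
        nlinarith [mul_pos hδ hδ, mul_pos (mul_pos hδ hδ) hδ]
      have h4 := mul_le_mul_of_nonneg_left hl
        (mul_nonneg (by linarith : 0 ≤ 1 - w) (by linarith : 0 ≤ 1 + δ))
      nlinarith
    have h2 := mul_le_mul_of_nonneg_left h1 hc.le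
    rw [← hrel'] at h2
    have h5 : (1 - w) * PhiBar ξ ≤ (1 - w) * (c * ((1 + δ) * D)) := by linarith
    have := le_of_mul_le_mul_left h5 (by linarith)
    linarith
  · have := hb x hx
    rw [invRatio, inv_le_comm₀ (by have := inv_pos.2 hδ; linarith) hδ]
    linarith

lemma excess_pos {t : ℝ} (ht : t ∈ Ioo (0 : ℝ) 1) {w ξ δ : ℝ}
    (hξ : 0 ≤ ξ) (hδ : 0 < 1 + δ)
    (hb : 2 * PhiBar ξ ≤ (1 + δ) * (t / (1 - t) * excess γ w)) : 0 < excess γ w := by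
  have hc : 0 < t / (1 - t) := div_pos ht.1 (by linarith [ht.2])
  have hp := PhiBar_pos hξ
  have h1 : 0 < (1 + δ) * (t / (1 - t)) * excess γ w := by linarith
  exact pos_of_mul_pos_right h1 (by positivity)

/-! ### The marginal maximum likelihood estimator -/

/-- The log-likelihood is concave and lies below its tangent at `c`, by `log z ≤ z - 1`. The slope
is `(n - ∑ invRatio) / c` because `β / (1 + c β) = (1 - invRatio) / c`. -/
lemma logLik_le_tangent (h : IsSlabDensity γ Λ κ) {n : ℕ} (x : Fin n → ℝ) {w c : ℝ}
    (hw : w ∈ Icc (0 : ℝ) 1) (hc : c ∈ Ioc (0 : ℝ) 1) :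
    logLik γ x w ≤ logLik γ x c + (w - c) / c * (n - ∑ i, invRatio γ c (x i)) := by
  have key : ∀ i, Real.log (1 + w * beta γ (x i)) ≤
      Real.log (1 + c * beta γ (x i)) + (w - c) / c * (1 - invRatio γ c (x i)) := by
    intro i
    have hw' := one_add_mul_beta_pos h hw (x i)
    have hc' := one_add_mul_beta_pos h ⟨hc.1.le, hc.2⟩ (x i)
    have h1 := Real.log_le_sub_one_of_pos (div_pos hw' hc')
    rw [Real.log_div hw'.ne' hc'.ne'] at h1
    have h2 : (1 + w * beta γ (x i)) / (1 + c * beta γ (x i)) - 1 =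
        (w - c) / c * (1 - invRatio γ c (x i)) := by
      have hc0 := hc.1.ne'
      have hc'' := hc'.ne'
      have e1 := mul_inv_cancel₀ hc0
      have e2 := mul_inv_cancel₀ hc''
      rw [invRatio, div_eq_mul_inv, div_eq_mul_inv]
      linear_combination (1 - (1 + c * beta γ (x i))⁻¹ -
        w * beta γ (x i) * (1 + c * beta γ (x i))⁻¹) * e1 + w * c⁻¹ * e2
    linarith
  have hsum := Finset.sum_le_sum fun i (_ : i ∈ Finset.univ) => key i
  rw [Finset.sum_add_distrib, ← Finset.mul_sum, Finset.sum_sub_distrib] at hsum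
  simp only [Finset.sum_const, Finset.card_univ, Fintype.card_fin, nsmul_eq_mul, mul_one] at hsum
  rw [logLik, logLik]
  linarith

lemma continuousOn_logLik (h : IsSlabDensity γ Λ κ) {n : ℕ} (x : Fin n → ℝ) :
    ContinuousOn (logLik γ x) (Icc 0 1) := by
  refine continuousOn_const.add (continuousOn_finsetSum _ fun i _ => ?_)
  exact ContinuousOn.log (by fun_prop) fun w hw => (one_add_mul_beta_pos h hw (x i)).ne'

lemma one_div_mem_Ioc {n : ℕ} (hn : 0 < n) : 1 / (n : ℝ) ∈ Ioc (0 : ℝ) 1 := by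
  have : (1 : ℝ) ≤ n := by exact_mod_cast hn
  exact ⟨by positivity, by rw [div_le_one (by linarith)]; exact this⟩

/-- A nonnegative score at `c` makes a maximiser over `[c, 1]` a maximiser over the whole range. A
weak inequality suffices because `wHat` is the supremum of the maximisers. -/
lemma le_wHat (h : IsSlabDensity γ Λ κ) {n : ℕ} (hn : 0 < n) (x : Fin n → ℝ) {c : ℝ}
    (hc : c ∈ Icc (1 / (n : ℝ)) 1) (hs : ∑ i, invRatio γ c (x i) ≤ n) : c ≤ wHat γ x := by
  have hn1 := (one_div_mem_Ioc hn).1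
  have hc0 : 0 < c := hn1.trans_le hc.1
  obtain ⟨w₀, hw₀, hmax⟩ := isCompact_Icc.exists_isMaxOn (nonempty_Icc.2 hc.2)
    ((continuousOn_logLik h x).mono (Icc_subset_Icc_left hc0.le))
  refine hw₀.1.trans (le_csSup ⟨1, fun w hw => hw.1.2⟩ ⟨⟨hc.1.trans hw₀.1, hw₀.2⟩, fun w hw => ?_⟩)
  rcases le_total c w with hcw | hcw
  · exact hmax ⟨hcw, hw.2⟩
  · have h1 := logLik_le_tangent h x (w := w) ⟨hn1.le.trans hw.1, hw.2⟩ ⟨hc0, hc.2⟩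
    have h2 : (w - c) / c * (n - ∑ i, invRatio γ c (x i)) ≤ 0 :=
      mul_nonpos_of_nonpos_of_nonneg (div_nonpos_of_nonpos_of_nonneg (by linarith) hc0.le)
        (by linarith)
    have h3 : logLik γ x c ≤ logLik γ x w₀ := hmax (left_mem_Icc.2 hc.2)
    change logLik γ x w ≤ logLik γ x w₀
    linarith

/-- A negative score at `c` puts the likelihood strictly below its value at `c` everywhere to the
right, leaving no maximiser there. -/
lemma wHat_le (h : IsSlabDensity γ Λ κ) {n : ℕ} (hn : 0 < n) (x : Fin n → ℝ) {c : ℝ}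
    (hc : c ∈ Icc (1 / (n : ℝ)) 1) (hs : n < ∑ i, invRatio γ c (x i)) : wHat γ x ≤ c := by
  have hn1 := (one_div_mem_Ioc hn).1
  have hc0 : 0 < c := hn1.trans_le hc.1
  refine Real.sSup_le (fun w hw => ?_) hc0.le
  by_contra hcw
  have hcw' : c < w := not_le.1 hcw
  have h1 := logLik_le_tangent h x (w := w) ⟨hn1.le.trans hw.1.1, hw.1.2⟩ ⟨hc0, hc.2⟩
  have h2 : (w - c) / c * (n - ∑ i, invRatio γ c (x i)) < 0 :=
    mul_neg_of_pos_of_neg (div_pos (by linarith) hc0) (by linarith)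
  have h3 : logLik γ x c ≤ logLik γ x w := hw.2 hc
  linarith

lemma wHat_mem (h : IsSlabDensity γ Λ κ) {n : ℕ} (hn : 0 < n) (x : Fin n → ℝ) :
    wHat γ x ∈ Icc (1 / (n : ℝ)) 1 := by
  have hn1 := one_div_mem_Ioc hn
  refine ⟨?_, Real.sSup_le (fun w hw => hw.1.2) zero_le_one⟩
  obtain ⟨w₀, hw₀, hmax⟩ := isCompact_Icc.exists_isMaxOn (nonempty_Icc.2 hn1.2)
    ((continuousOn_logLik h x).mono (Icc_subset_Icc_left hn1.1.le))
  exact hw₀.1.trans (le_csSup ⟨1, fun w hw => hw.1.2⟩ ⟨hw₀, hmax⟩)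

/-- The event `ŵ < c` is the union, over admissible rationals `q < c`, of the events that the score
at `q` is negative, so no measurable selection is needed. -/
lemma measurable_wHat (h : IsSlabDensity γ Λ κ) {n : ℕ} (hn : 0 < n) :
    Measurable (wHat γ : (Fin n → ℝ) → ℝ) := by
  refine measurable_of_Iio fun c => ?_
  rcases lt_or_ge 1 c with hc | hc
  · have : (wHat γ : (Fin n → ℝ) → ℝ) ⁻¹' Iio c = univ :=
      eq_univ_of_forall fun x => (wHat_mem h hn x).2.trans_lt hc
    rw [this]; exact MeasurableSet.univ
  have : (wHat γ : (Fin n → ℝ) → ℝ) ⁻¹' Iio c =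
      ⋃ q : {q : ℚ // (q : ℝ) ∈ Icc (1 / (n : ℝ)) 1 ∧ (q : ℝ) < c},
        {x | (n : ℝ) < ∑ i, invRatio γ (q : ℚ) (x i)} := by
    ext x
    simp only [mem_preimage, mem_Iio, mem_iUnion, mem_ofPred_eq]
    constructor
    · intro hx
      obtain ⟨q, hq1, hq2⟩ := exists_rat_btwn hx
      have hq : (q : ℝ) ∈ Icc (1 / (n : ℝ)) 1 :=
        ⟨(wHat_mem h hn x).1.trans hq1.le, hq2.le.trans hc⟩
      refine ⟨⟨q, hq, hq2⟩, ?_⟩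
      by_contra hcon
      exact absurd (le_wHat h hn x hq (not_lt.1 hcon)) (not_le.2 hq1)
    · rintro ⟨⟨q, hq, hq2⟩, hx⟩
      exact (wHat_le h hn x hq hx).trans_lt hq2
  rw [this]
  refine MeasurableSet.iUnion fun q => measurableSet_lt measurable_const ?_
  exact Finset.measurable_sum _ fun i _ =>
    (measurable_invRatio h _).comp (measurable_pi_apply i)

lemma measurable_comp_finset {α : Type*} [MeasurableSpace α] {n : ℕ} {φ : α → Finset (Fin n)}
    (hφ : ∀ i, MeasurableSet {x | i ∈ φ x}) (F : Finset (Fin n) → ℝ) :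
    Measurable fun x => F (φ x) := by
  let _ : MeasurableSpace (Finset (Fin n)) := ⊤
  have : Measurable φ := by
    refine measurable_to_countable' fun s => ?_
    have : φ ⁻¹' {s} = ⋂ i, {x | i ∈ φ x ↔ i ∈ s} := by
      ext x
      simp [Finset.ext_iff]
    rw [this]
    refine MeasurableSet.iInter fun i => ?_
    by_cases hi : i ∈ s
    · simpa [hi] using hφ i
    · simp only [hi, iff_false]
      exact (hφ i).compl
  exact (measurable_from_top (f := F)).comp this

lemma measurableSet_qValue_le (h : IsSlabDensity γ Λ κ) {n : ℕ} (hn : 0 < n) (t : ℝ)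
    (i : Fin n) : MeasurableSet {x : Fin n → ℝ | qValue γ (wHat γ x) (x i) ≤ t} := by
  have hw := measurable_wHat h hn
  have hP : Measurable fun x : Fin n → ℝ => PhiBar |x i| :=
    continuous_PhiBar.measurable.comp (measurable_pi_apply i).abs
  have hG : Measurable fun x : Fin n → ℝ => GBar γ |x i| :=
    (continuous_GBar h).measurable.comp (measurable_pi_apply i).abs
  have : (fun x : Fin n → ℝ => qValue γ (wHat γ x) (x i)) = fun x =>
      (1 - wHat γ x) * PhiBar |x i| /
        ((1 - wHat γ x) * PhiBar |x i| + wHat γ x * GBar γ |x i|) := by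
    funext x
    have hx := wHat_mem h hn x
    exact qValue_eq h ⟨(one_div_mem_Ioc hn).1.le.trans hx.1, hx.2⟩ _
  refine measurableSet_le ?_ measurable_const
  rw [this]
  exact ((hw.const_sub 1).mul hP).div (((hw.const_sub 1).mul hP).add (hw.mul hG))

lemma measurableSet_mem_eBayesQ (h : IsSlabDensity γ Λ κ) {n : ℕ} (hn : 0 < n) (t : ℝ)
    (i : Fin n) : MeasurableSet {x : Fin n → ℝ | i ∈ eBayesQ γ t x} := by
  simpa [eBayesQ] using measurableSet_qValue_le h hn t i

lemma measurableSet_mem_eBayesQZero (h : IsSlabDensity γ Λ κ) {n : ℕ} (hn : 0 < n) (t ℓ : ℝ)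
    (i : Fin n) : MeasurableSet {x : Fin n → ℝ | i ∈ eBayesQZero γ t ℓ x} := by
  have : {x : Fin n → ℝ | i ∈ eBayesQZero γ t ℓ x} =
      {x | qValue γ (wHat γ x) (x i) ≤ t} ∩ {x | omega γ n ℓ < wHat γ x} := by
    ext x; simp [eBayesQZero]
  rw [this]
  exact (measurableSet_qValue_le h hn t i).inter
    (measurableSet_lt measurable_const (measurable_wHat h hn))

/-! ### Concentration under the law of the data -/

instance {n : ℕ} (θ : Fin n → ℝ) : IsProbabilityMeasure (dataLaw θ) := by
  unfold dataLaw; infer_instance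

lemma dataLaw_map_eval {n : ℕ} (θ : Fin n → ℝ) (i : Fin n) :
    (dataLaw θ).map (fun x => x i) = gaussianReal (θ i) 1 :=
  (measurePreserving_eval (fun i => gaussianReal (θ i) 1) i).map_eq

lemma integral_dataLaw_eval {n : ℕ} (θ : Fin n → ℝ) (i : Fin n) {f : ℝ → ℝ} (hf : Measurable f) :
    ∫ x, f (x i) ∂(dataLaw θ) = ∫ y, f y ∂(gaussianReal (θ i) 1) := by
  rw [← dataLaw_map_eval θ i, integral_map (measurable_pi_apply i).aemeasurable
    hf.aestronglyMeasurable]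

/-- Chebyshev's inequality for a sum over the true null hypotheses. -/
lemma dataLaw_null_sum_deviation {n : ℕ} (θ : Fin n → ℝ) {f : ℝ → ℝ} (hf : Measurable f) {B : ℝ}
    (hB : ∀ y, |f y| ≤ B) {m v r : ℝ} (hm : ∫ y, f y ∂(gaussianReal 0 1) = m) (a : ℝ)
    (hv : ∫ y, (f y - a) ^ 2 ∂(gaussianReal 0 1) ≤ v) (hr : 0 < r) :
    (dataLaw θ).real {x | r ≤ |∑ i with θ i = 0, f (x i) -
      ((Finset.univ.filter fun i => θ i = 0).card : ℝ) * m|} ≤ n * v / r ^ 2 := by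
  set N := Finset.univ.filter fun i => θ i = 0
  have hL : ∀ i, MemLp (fun x : Fin n → ℝ => f (x i)) 2 (dataLaw θ) := fun i =>
    MemLp.of_bound (hf.comp (measurable_pi_apply i)).aestronglyMeasurable B
      (ae_of_all _ fun x => hB _)
  have hLf : MemLp f 2 (gaussianReal 0 1) :=
    MemLp.of_bound hf.aestronglyMeasurable B (ae_of_all _ fun x => hB _)
  have hLs : MemLp (fun x : Fin n → ℝ => ∑ i ∈ N, f (x i)) 2 (dataLaw θ) :=
    memLp_finsetSum _ fun i _ => hL i
  have hmean : ∫ x, ∑ i ∈ N, f (x i) ∂(dataLaw θ) = N.card * m := by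
    rw [integral_finsetSum _ fun i _ => (hL i).integrable (by norm_num)]
    rw [Finset.sum_congr rfl (g := fun _ => m), Finset.sum_const, nsmul_eq_mul]
    intro i hi
    rw [integral_dataLaw_eval θ i hf, (Finset.mem_filter.1 hi).2, hm]
  have hv0 : 0 ≤ v := (integral_nonneg fun y => sq_nonneg _).trans hv
  -- The variance is at most the second moment about any centre; `a = 1` serves `invRatio` and `a =
  -- 0` the indicators.
  have hvar1 : Var[f; gaussianReal 0 1] ≤ v := by
    have := variance_sub_const hf.aestronglyMeasurable (μ := gaussianReal 0 1) a
    rw [← this]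
    exact (variance_le_expectation_sq (hf.sub_const a).aestronglyMeasurable).trans hv
  have hvar : Var[fun x : Fin n → ℝ => ∑ i ∈ N, f (x i); dataLaw θ] ≤ n * v := by
    have e : (fun x : Fin n → ℝ => ∑ i ∈ N, f (x i)) = ∑ i ∈ N, fun x : Fin n → ℝ => f (x i) := by
      funext x; simp
    rw [e, IndepFun.variance_sum (fun i _ => hL i)]
    · calc ∑ i ∈ N, Var[fun x : Fin n → ℝ => f (x i); dataLaw θ] ≤ ∑ i ∈ N, v := by
            refine Finset.sum_le_sum fun i hi => ?_
            have h1 : Var[f ∘ (fun x : Fin n → ℝ => x i); dataLaw θ] = Var[f; gaussianReal 0 1] := by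
              rw [← variance_map, dataLaw_map_eval, (Finset.mem_filter.1 hi).2]
              · exact hf.aemeasurable
              · exact (measurable_pi_apply i).aemeasurable
            exact h1.le.trans hvar1
        _ = N.card * v := by rw [Finset.sum_const, nsmul_eq_mul]
        _ ≤ n * v := by
            refine mul_le_mul_of_nonneg_right ?_ hv0
            have := Finset.card_le_univ N
            rw [Fintype.card_fin] at this
            exact_mod_cast this
    · intro i _ j _ hij
      exact (iIndepFun_pi (μ := fun i => gaussianReal (θ i) 1) (X := fun _ => f)
        fun i => hf.aemeasurable).indepFun hij
  have := meas_ge_le_variance_div_sq hLs hr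
  rw [hmean] at this
  have h2 := ENNReal.toReal_mono ENNReal.ofReal_ne_top this
  rw [ENNReal.toReal_ofReal (div_nonneg (variance_nonneg _ _) (sq_nonneg _))] at h2
  refine h2.trans ?_
  gcongr

/-- Markov's inequality for the number of nonnull observations in a set. -/
lemma dataLaw_signal_count {n : ℕ} (θ : Fin n → ℝ) {B : Set ℝ} (hB : MeasurableSet B) {p r : ℝ}
    (hp : ∀ i, θ i ≠ 0 → (gaussianReal (θ i) 1).real B ≤ p) (hr : 0 < r) :
    (dataLaw θ).real {x | r ≤ ∑ i with θ i ≠ 0, B.indicator 1 (x i)} ≤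
      ((Finset.univ.filter fun i => θ i ≠ 0).card : ℝ) * p / r := by
  set S := Finset.univ.filter fun i => θ i ≠ 0
  have hf : Measurable (B.indicator (1 : ℝ → ℝ)) := measurable_one.indicator hB
  have hf0 : ∀ y, 0 ≤ B.indicator (1 : ℝ → ℝ) y := indicator_nonneg fun _ _ => zero_le_one
  have hi : ∀ i, Integrable (fun x : Fin n → ℝ => B.indicator (1 : ℝ → ℝ) (x i)) (dataLaw θ) := by
    intro i
    refine Integrable.of_bound (hf.comp (measurable_pi_apply i)).aestronglyMeasurable 1
      (ae_of_all _ fun x => ?_)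
    rw [Real.norm_of_nonneg (hf0 _)]
    exact indicator_le_self' (fun _ _ => zero_le_one) _
  have h1 := mul_meas_ge_le_integral_of_nonneg (μ := dataLaw θ)
    (f := fun x => ∑ i ∈ S, B.indicator (1 : ℝ → ℝ) (x i))
    (ae_of_all _ fun x => Finset.sum_nonneg fun i _ => hf0 _)
    (integrable_finsetSum _ fun i _ => hi i) r
  rw [le_div_iff₀ hr, mul_comm]
  refine h1.trans ?_
  rw [integral_finsetSum _ fun i _ => hi i, ← nsmul_eq_mul, ← Finset.sum_const]
  refine Finset.sum_le_sum fun i hiS => ?_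
  rw [integral_dataLaw_eval θ i hf, integral_indicator_one hB]
  exact hp i (Finset.mem_filter.1 hiS).2

/-- Chebyshev is enough, since the distance from the signals to the threshold tends to infinity and
no rate is needed. -/
lemma gaussianReal_abs_lt_le {μ b : ℝ} (hb : b < |μ|) :
    (gaussianReal μ 1).real {y | |y| < b} ≤ 1 / (|μ| - b) ^ 2 := by
  have h1 := meas_ge_le_variance_div_sq (μ := gaussianReal μ 1) (X := id)
    (memLp_id_gaussianReal 2) (sub_pos.2 hb)
  simp only [variance_id_gaussianReal, id, integral_id_gaussianReal, NNReal.coe_one] at h1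
  have h2 := ENNReal.toReal_mono ENNReal.ofReal_ne_top h1
  rw [ENNReal.toReal_ofReal (by positivity)] at h2
  refine (measureReal_mono fun y hy => ?_).trans h2
  have hy' : |y| < b := hy
  change |μ| - b ≤ |y - μ|
  have := abs_sub_abs_le_abs_sub μ y
  rw [abs_sub_comm] at this
  linarith

/-! ### The false discovery rate at a fixed sample size -/

lemma abs_integral_sub_le {α : Type*} [MeasurableSpace α] {μ : Measure α} [IsProbabilityMeasure μ]
    {F : α → ℝ} (hF : Measurable F) {t ε b : ℝ} (hε : 0 ≤ ε) (h1 : ∀ x, |F x - t| ≤ 1) {B : Set α}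
    (hB : ∀ x ∉ B, |F x - t| ≤ ε) (hb : μ.real B ≤ b) : |∫ x, F x ∂μ - t| ≤ ε + b := by
  have hi : Integrable (fun x => F x - t) μ :=
    Integrable.of_bound (hF.sub_const t).aestronglyMeasurable 1 (ae_of_all _ h1)
  have hFi : Integrable F μ := 
    (hi.add (integrable_const t)).congr (ae_of_all _ fun x => by simp)
  -- A measurable subset of `B`, so `B` itself need not be measurable.
  set B' := {x | ε < |F x - t|}
  have hB'm : MeasurableSet B' := measurableSet_lt measurable_const (hF.sub_const t).abs
  have hB' : μ.real B' ≤ b := by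
    refine (measureReal_mono fun x hx => ?_).trans hb
    by_contra hxB
    exact absurd (hB x hxB) (not_le.2 hx)
  have e : ∫ x, F x ∂μ - t = ∫ x, (F x - t) ∂μ := by
    rw [integral_sub hFi (integrable_const t)]; simp
  have hind : Integrable (B'.indicator (1 : α → ℝ)) μ :=
    (integrable_const (1 : ℝ)).indicator hB'm
  rw [e]
  calc |∫ x, (F x - t) ∂μ| ≤ ∫ x, |F x - t| ∂μ := abs_integral_le_integral_abs
    _ ≤ ∫ x, (ε + B'.indicator (1 : α → ℝ) x) ∂μ := by
        refine integral_mono hi.abs ((integrable_const ε).add hind) fun x => ?_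
        by_cases hx : x ∈ B'
        · simp only [indicator_of_mem hx, Pi.one_apply]
          linarith [h1 x]
        · simp only [indicator_of_notMem hx, add_zero]
          exact not_lt.1 hx
    _ = ε + μ.real B' := by
        rw [integral_add (integrable_const ε) hind, integral_indicator_one hB'm]; simp
    _ ≤ ε + b := by linarith

/-- `V / (V + T) - t = ((1 - t) V - t T) / (V + T)`. Both terms of the numerator are within `η t s`
of `t s`, and the denominator is at least `s / 2`, which also exceeds `1` weakly and removes the
maximum. -/
lemma abs_div_max_sub_le {V T s t η : ℝ} (ht : t ∈ Ioo (0 : ℝ) 1) (hη : 0 ≤ η) (hη1 : η ≤ 1 / 2)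
    (hs : 2 ≤ s) (hV0 : 0 ≤ V) (hV : |V - t / (1 - t) * s| ≤ η * (t / (1 - t) * s))
    (hT : (1 - η) * s ≤ T) (hTs : T ≤ s) : |V / max 1 (V + T) - t| ≤ 4 * η := by
  have ht1 : 0 < 1 - t := by linarith [ht.2]
  have hT' : s / 2 ≤ T := by nlinarith
  rw [max_eq_right (by linarith)]
  have hpos : 0 < V + T := by linarith
  have hc : (1 - t) * (t / (1 - t) * s) = t * s := by field_simp
  have hV' : |(1 - t) * V - t * s| ≤ η * (t * s) := by
    rw [← hc, ← mul_sub, abs_mul, abs_of_pos ht1]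
    nlinarith [mul_le_mul_of_nonneg_left hV ht1.le]
  rw [div_sub' hpos.ne', abs_div, abs_of_pos hpos, div_le_iff₀ hpos]
  have hts : t * s ≤ s := mul_le_of_le_one_left (by linarith) ht.2.le
  have htT : t * T ≤ t * s := mul_le_mul_of_nonneg_left hTs ht.1.le
  have htT' : t * ((1 - η) * s) ≤ t * T := mul_le_mul_of_nonneg_left hT ht.1.le
  have hηs : η * (t * s) ≤ η * s := mul_le_mul_of_nonneg_left hts hη
  have hηT : η * (s / 2) ≤ η * (V + T) := mul_le_mul_of_nonneg_left (by linarith) hη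
  obtain ⟨l, u⟩ := abs_le.1 hV'
  rw [abs_le]
  constructor <;> nlinarith

lemma qValue_le_mono (h : IsSlabDensity γ Λ κ) {t w w' : ℝ} (ht : t ∈ Ioo (0 : ℝ) 1)
    (hw : 0 < w) (hww' : w ≤ w') (hw' : w' ≤ 1) {x : ℝ} (hx : qValue γ w x ≤ t) :
    qValue γ w' x ≤ t := by
  rw [qValue_le_iff h ⟨hw, hww'.trans hw'⟩ ht.2] at hx
  rw [qValue_le_iff h ⟨hw.trans_le hww', hw'⟩ ht.2]
  have hc : 0 < t / (1 - t) := div_pos ht.1 (by linarith [ht.2])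
  calc (1 - w') * PhiBar |x| ≤ (1 - w) * PhiBar |x| :=
        mul_le_mul_of_nonneg_right (by linarith) (PhiBar_nonneg _)
    _ ≤ _ := hx
    _ ≤ _ := mul_le_mul_of_nonneg_right (mul_le_mul_of_nonneg_left hww' hc.le)
        (GBar_nonneg h _)

lemma measurableSet_le_abs (ξ : ℝ) : MeasurableSet {y : ℝ | ξ ≤ |y|} :=
  measurableSet_le measurable_const measurable_abs

/-- Concentration of the number of null observations beyond a threshold. -/
lemma dataLaw_null_count_deviation {n : ℕ} (θ : Fin n → ℝ) {ξ r : ℝ} (hξ : 0 ≤ ξ) (hr : 0 < r) :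
    (dataLaw θ).real {x | r ≤ |∑ i with θ i = 0, {y : ℝ | ξ ≤ |y|}.indicator 1 (x i) -
      ((Finset.univ.filter fun i => θ i = 0).card : ℝ) * (2 * PhiBar ξ)|} ≤
      n * (2 * PhiBar ξ) / r ^ 2 := by
  have hm : ∫ y, {y : ℝ | ξ ≤ |y|}.indicator (1 : ℝ → ℝ) y ∂(gaussianReal 0 1) =
      2 * PhiBar ξ := by
    rw [integral_indicator_one (measurableSet_le_abs ξ), gaussianReal_real_abs_ge hξ]
  refine dataLaw_null_sum_deviation θ (measurable_one.indicator (measurableSet_le_abs ξ))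
    (B := 1) (fun y => ?_) hm 0 ?_ hr
  · by_cases hy : y ∈ {y : ℝ | ξ ≤ |y|}
    · simp [indicator_of_mem hy]
    · simp [indicator_of_notMem hy]
  · rw [← hm]
    refine le_of_eq (integral_congr_ae (ae_of_all _ fun y => ?_))
    by_cases hy : y ∈ {y : ℝ | ξ ≤ |y|}
    · simp [indicator_of_mem hy]
    · simp [indicator_of_notMem hy]

/-- Concentration of the sum of the inverse likelihood ratios of the null observations. -/
lemma dataLaw_null_invRatio_deviation (h : IsSlabDensity γ Λ κ) {n : ℕ} (θ : Fin n → ℝ)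
    {w r : ℝ} (hw : w ∈ Icc (0 : ℝ) (1 / 2)) (hr : 0 < r) :
    (dataLaw θ).real {x | r ≤ |∑ i with θ i = 0, invRatio γ w (x i) -
      ((Finset.univ.filter fun i => θ i = 0).card : ℝ) * (1 + excess γ w)|} ≤
      n * (2 * excess γ w) / r ^ 2 := by
  refine dataLaw_null_sum_deviation θ (measurable_invRatio h w) (B := 2) (fun y => ?_)
    (integral_invRatio h hw) 1 (integral_sq_invRatio_le h hw) hr
  rw [abs_of_nonneg (invRatio_nonneg h ⟨hw.1, by linarith [hw.2]⟩ y)]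
  exact invRatio_le_two h hw y

lemma card_filter_eq_sum {n : ℕ} (s : Finset (Fin n)) (p : Fin n → Prop) [DecidablePred p] :
    ((s.filter p).card : ℝ) = ∑ i with p i, if i ∈ s then 1 else 0 := by
  rw [← Finset.sum_filter, Finset.filter_filter, Finset.sum_const, nsmul_eq_mul, mul_one]
  congr 2
  ext i; simp [and_comm]

/-- The proportion of false discoveries at a data point where the estimated weight, the
counts of nulls beyond two thresholds, and the count of missed signals are all typical. -/
lemma abs_fdp_sub_le (h : IsSlabDensity γ Λ κ) {t η : ℝ} (ht : t ∈ Ioo (0 : ℝ) 1) (hη : 0 ≤ η)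
    (hη1 : η ≤ 1 / 2) {n s : ℕ} {θ : Fin n → ℝ}
    (hcard : (Finset.univ.filter fun i => θ i ≠ 0).card = s) (hs : 2 ≤ s) {w₁ w₂ ξ₁ ξ₂ ŵ : ℝ}
    (hw₁ : 0 < w₁) (hw₂ : w₂ ≤ 1) (hŵ : ŵ ∈ Icc w₁ w₂)
    (hξ₁ : ∀ x, qValue γ w₁ x ≤ t ↔ ξ₁ ≤ |x|) (hξ₂ : ∀ x, qValue γ w₂ x ≤ t ↔ ξ₂ ≤ |x|)
    {x : Fin n → ℝ} {R : Finset (Fin n)} (hR : ∀ i, i ∈ R ↔ qValue γ ŵ (x i) ≤ t)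
    (hlow : (1 - η) * (t / (1 - t) * s) ≤ ∑ i with θ i = 0, {y : ℝ | ξ₁ ≤ |y|}.indicator 1 (x i))
    (hhigh : ∑ i with θ i = 0, {y : ℝ | ξ₂ ≤ |y|}.indicator 1 (x i) ≤ (1 + η) * (t / (1 - t) * s))
    (hmiss : ∑ i with θ i ≠ 0, {y : ℝ | |y| < ξ₁ + 1}.indicator 1 (x i) ≤ η * s) :
    |((R.filter fun i => θ i = 0).card : ℝ) / max 1 (R.card : ℝ) - t| ≤ 4 * η := by
  -- Rejections grow with the weight, so the random rejection set lies between those of the two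
  -- deterministic thresholds `ξ₁` and `ξ₂`.
  have r1 : ∀ i, ξ₁ ≤ |x i| → i ∈ R := fun i hi =>
    (hR i).2 (qValue_le_mono h ht hw₁ hŵ.1 (hŵ.2.trans hw₂) ((hξ₁ _).2 hi))
  have r2 : ∀ i, i ∈ R → ξ₂ ≤ |x i| := fun i hi =>
    (hξ₂ _).1 (qValue_le_mono h ht (hw₁.trans_le hŵ.1) hŵ.2 hw₂ ((hR i).1 hi))
  have hsplit : (R.card : ℝ) = (R.filter fun i => θ i = 0).card +
      (R.filter fun i => ¬ θ i = 0).card := by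
    rw [← Finset.card_filter_add_card_filter_not (s := R) fun i => θ i = 0]; push_cast; rfl
  have hTs : ((R.filter fun i => ¬ θ i = 0).card : ℝ) ≤ s := by
    rw [← hcard]
    exact_mod_cast Finset.card_le_card (Finset.filter_subset_filter _ (Finset.subset_univ R))
  rw [hsplit]
  refine abs_div_max_sub_le ht hη hη1 (by exact_mod_cast hs) (Nat.cast_nonneg _) ?_ ?_ hTs
  · rw [card_filter_eq_sum, abs_le]
    constructor
    · have : ∑ i with θ i = 0, {y : ℝ | ξ₁ ≤ |y|}.indicator 1 (x i) ≤
          ∑ i with θ i = 0, if i ∈ R then (1 : ℝ) else 0 := by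
        refine Finset.sum_le_sum fun i _ => ?_
        by_cases hi : ξ₁ ≤ |x i|
        · rw [if_pos (r1 i hi)]; exact indicator_le_self' (fun _ _ => zero_le_one) _
        · rw [indicator_of_notMem (by exact hi)]; split_ifs <;> norm_num
      linarith
    · have : (∑ i with θ i = 0, if i ∈ R then (1 : ℝ) else 0) ≤
          ∑ i with θ i = 0, {y : ℝ | ξ₂ ≤ |y|}.indicator 1 (x i) := by
        refine Finset.sum_le_sum fun i _ => ?_
        by_cases hi : i ∈ R
        · rw [if_pos hi, indicator_of_mem (by exact r2 i hi)]; rfl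
        · rw [if_neg hi]; exact indicator_nonneg (fun _ _ => zero_le_one) _
      linarith
  · rw [card_filter_eq_sum]
    have h1 : ∑ i with θ i ≠ 0, (1 : ℝ) ≤ ∑ i with θ i ≠ 0,
        ((if i ∈ R then (1 : ℝ) else 0) + {y : ℝ | |y| < ξ₁ + 1}.indicator 1 (x i)) := by
      refine Finset.sum_le_sum fun i _ => ?_
      by_cases hi : |x i| < ξ₁ + 1
      · rw [indicator_of_mem (by exact hi)]; split_ifs <;> simp
      · rw [indicator_of_notMem (by exact hi), if_pos (r1 i (by linarith))]; norm_num
    rw [Finset.sum_add_distrib, Finset.sum_const, hcard, nsmul_eq_mul, mul_one] at h1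
    linarith

/-- A threshold `ξ` of the `q`-value for the weight `w`, together with comparison bounds between
its null probability and the excess. -/
structure IsGoodThreshold (γ : ℝ → ℝ) (t δ w ξ : ℝ) : Prop where
  one_le : 1 ≤ ξ
  qValue_le_iff : ∀ x, qValue γ w x ≤ t ↔ ξ ≤ |x|
  le_tail : (1 - δ) * (t / (1 - t) * excess γ w) ≤ 2 * PhiBar ξ
  tail_le : 2 * PhiBar ξ ≤ (1 + δ) * (t / (1 - t) * excess γ w)
  invRatio_le : ∀ x, ξ + 1 ≤ |x| → invRatio γ w x ≤ δ / 4

lemma card_null {n s : ℕ} {θ : Fin n → ℝ}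
    (hcard : (Finset.univ.filter fun i => θ i ≠ 0).card = s) :
    ((Finset.univ.filter fun i => θ i = 0).card : ℝ) = n - s := by
  have := Finset.card_filter_add_card_filter_not (s := (Finset.univ : Finset (Fin n)))
    fun i => θ i = 0
  rw [Finset.card_univ, Fintype.card_fin] at this
  have h2 : (n : ℝ) = ((Finset.univ.filter fun i => θ i = 0).card : ℝ) + s := by
    rw [← hcard]; exact_mod_cast this.symm
  rw [h2]; ring

/-- Bounds on the excess at `(1 ± δ) w` when the excess at `w` is `σ`. -/
lemma excess_bounds (h : IsSlabDensity γ Λ κ) {δ w σ : ℝ} (hδ : 0 < δ) (hδ1 : δ ≤ 1 / 12)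
    (hw : 0 < w) (hwδ : w ≤ δ / 8) (hσ : excess γ w = σ) :
    (1 + δ) * σ ≤ excess γ ((1 + δ) * w) ∧ excess γ ((1 + δ) * w) ≤ (1 + δ) ^ 3 * σ ∧
    excess γ ((1 - δ) * w) ≤ (1 - δ) * σ ∧ (1 - δ) ^ 3 * σ ≤ excess γ ((1 - δ) * w) := by
  have hσ0 : 0 ≤ σ := hσ ▸ excess_nonneg h ⟨hw.le, by linarith⟩
  have hw₂ : (1 + δ) * w ≤ δ / 4 := by nlinarith
  have hw₁ : 0 < (1 - δ) * w := mul_pos (by linarith) hw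
  have a1 := mul_excess_le h hw (by nlinarith : w ≤ (1 + δ) * w) (by linarith)
  have a2 := excess_le_mul h hw (by nlinarith : w ≤ (1 + δ) * w) (by linarith)
  have a3 := mul_excess_le h hw₁ (by nlinarith : (1 - δ) * w ≤ w) (by linarith)
  have a4 := excess_le_mul h hw₁ (by nlinarith : (1 - δ) * w ≤ w) (by linarith)
  rw [mul_div_assoc, div_self hw.ne', mul_one, hσ] at a1 a2
  have e : w / ((1 - δ) * w) = (1 - δ)⁻¹ := by
    rw [mul_comm, div_mul_eq_div_div, div_self hw.ne', one_div]
  have hd : 0 < 1 - δ := by linarith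
  rw [e, hσ] at a3 a4
  have H₁ := excess_nonneg h (w := (1 - δ) * w) ⟨hw₁.le, by nlinarith⟩
  refine ⟨a1, a2.trans ?_, ?_, ?_⟩
  · refine mul_le_mul_of_nonneg_right ?_ hσ0
    rw [div_le_iff₀ (by linarith)]
    have : 1 ≤ (1 + δ) * (1 - (1 + δ) * w) := by nlinarith
    calc (1 + δ) ^ 2 = (1 + δ) ^ 2 * 1 := by ring
      _ ≤ (1 + δ) ^ 2 * ((1 + δ) * (1 - (1 + δ) * w)) :=
          mul_le_mul_of_nonneg_left this (sq_nonneg _)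
      _ = _ := by ring
  · rwa [inv_mul_le_iff₀ hd] at a3
  · have e2 : (1 - δ)⁻¹ ^ 2 / (1 - w) * excess γ ((1 - δ) * w) =
        excess γ ((1 - δ) * w) / ((1 - δ) ^ 2 * (1 - w)) := by
      have : 1 - w ≠ 0 := by linarith
      field_simp
    rw [e2, le_div_iff₀ (mul_pos (by positivity) (by linarith))] at a4
    calc (1 - δ) ^ 3 * σ = σ * ((1 - δ) ^ 2 * (1 - δ)) := by ring
      _ ≤ σ * ((1 - δ) ^ 2 * (1 - w)) := by gcongr; linarith
      _ ≤ _ := a4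

/-- Location of the marginal maximum likelihood estimator at typical data points. -/
lemma wHat_mem_Icc (h : IsSlabDensity γ Λ κ) {n s : ℕ} (hn : 0 < n) {θ : Fin n → ℝ}
    (hcard : (Finset.univ.filter fun i => θ i ≠ 0).card = s) (hs : 0 < s)
    {δ w ξ : ℝ} (hδ : 0 < δ) (hδ1 : δ ≤ 1 / 12) (hw : 0 < w) (hwδ : w ≤ δ / 8)
    (hwn : 1 / (n : ℝ) ≤ (1 - δ) * w) (hσ : excess γ w = s / n) (hσδ : (s : ℝ) / n ≤ δ / 8)
    (hξ : ∀ x, ξ + 1 ≤ |x| → invRatio γ ((1 - δ) * w) x ≤ δ / 4)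
    {x : Fin n → ℝ}
    (h₁ : |∑ i with θ i = 0, invRatio γ ((1 - δ) * w) (x i) -
      ((Finset.univ.filter fun i => θ i = 0).card : ℝ) * (1 + excess γ ((1 - δ) * w))| < δ / 2 * s)
    (h₂ : |∑ i with θ i = 0, invRatio γ ((1 + δ) * w) (x i) -
      ((Finset.univ.filter fun i => θ i = 0).card : ℝ) * (1 + excess γ ((1 + δ) * w))| < δ / 2 * s)
    (hmiss : ∑ i with θ i ≠ 0, {y : ℝ | |y| < ξ + 1}.indicator 1 (x i) ≤ δ / 8 * s) :
    wHat γ x ∈ Icc ((1 - δ) * w) ((1 + δ) * w) := by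
  obtain ⟨b1, -, b3, -⟩ := excess_bounds h hδ hδ1 hw hwδ hσ
  have hn0 : (0 : ℝ) < n := by exact_mod_cast hn
  have hs0 : (0 : ℝ) < s := by exact_mod_cast hs
  have hw₁ : 0 < (1 - δ) * w := mul_pos (by linarith) hw
  have hw₂ : (1 + δ) * w ≤ 1 / 2 := by nlinarith
  have hle : (1 - δ) * w ≤ (1 + δ) * w := by nlinarith
  have hsn : (s : ℝ) / n * n = s := div_mul_cancel₀ _ hn0.ne'
  have hsnle : (s : ℝ) ≤ δ / 8 * n := by rwa [div_le_iff₀ hn0] at hσδ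
  have hns : 0 ≤ (n : ℝ) - s := by nlinarith
  rw [card_null hcard] at h₁ h₂
  have tot : ∀ v : ℝ, ∑ i, invRatio γ v (x i) =
      ∑ i with θ i = 0, invRatio γ v (x i) + ∑ i with θ i ≠ 0, invRatio γ v (x i) := fun v =>
    (Finset.sum_filter_add_sum_filter_not _ _ _).symm
  constructor
  -- The budget is exact: the nulls give at most `n - s + (1 - δ) s + δ s / 2`, and the signals at
  -- most `2 · δ s / 8 + δ s / 4 = δ s / 2`, in total `n`.
  · refine le_wHat h hn x ⟨hwn, by linarith⟩ ?_
    rw [tot]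
    have hsig : ∑ i with θ i ≠ 0, invRatio γ ((1 - δ) * w) (x i) ≤
        ∑ i with θ i ≠ 0, (2 * {y : ℝ | |y| < ξ + 1}.indicator 1 (x i) + δ / 4) := by
      refine Finset.sum_le_sum fun i _ => ?_
      by_cases hi : |x i| < ξ + 1
      · rw [indicator_of_mem (by exact hi)]
        have := invRatio_le_two h ⟨hw₁.le, hle.trans hw₂⟩ (x i)
        simp only [Pi.one_apply]; linarith
      · rw [indicator_of_notMem (by exact hi)]
        have := hξ _ (not_lt.1 hi)
        linarith
    rw [Finset.sum_add_distrib, ← Finset.mul_sum, Finset.sum_const, hcard, nsmul_eq_mul] at hsig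
    have h3 : ((n : ℝ) - s) * excess γ ((1 - δ) * w) ≤ (1 - δ) * s := by
      calc ((n : ℝ) - s) * excess γ ((1 - δ) * w) ≤ ((n : ℝ) - s) * ((1 - δ) * (s / n)) :=
            mul_le_mul_of_nonneg_left b3 hns
        _ ≤ n * ((1 - δ) * (s / n)) := by
            refine mul_le_mul_of_nonneg_right (by linarith) ?_
            exact mul_nonneg (by linarith) (by positivity)
        _ = (1 - δ) * (s / n * n) := by ring
        _ = (1 - δ) * s := by rw [hsn]
    have h4 := (abs_lt.1 h₁).2
    nlinarith
  · refine wHat_le h hn x ⟨hwn.trans hle, by linarith⟩ ?_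
    rw [tot]
    have hsig : 0 ≤ ∑ i with θ i ≠ 0, invRatio γ ((1 + δ) * w) (x i) :=
      Finset.sum_nonneg fun i _ => invRatio_nonneg h ⟨by linarith, by linarith⟩ _
    have h3 : (1 + δ) * (1 - δ / 8) * s ≤ ((n : ℝ) - s) * excess γ ((1 + δ) * w) := by
      calc (1 + δ) * (1 - δ / 8) * s = ((1 - δ / 8) * n) * ((1 + δ) * (s / n)) := by
            rw [← hsn]; field_simp
        _ ≤ ((n : ℝ) - s) * ((1 + δ) * (s / n)) :=
            mul_le_mul_of_nonneg_right (by linarith) (by positivity)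
        _ ≤ _ := mul_le_mul_of_nonneg_left b1 hns
    have h4 := (abs_lt.1 h₂).1
    -- This is the surplus `((1 + δ)(1 - δ / 8) - 1 - δ / 2) s` of the null sum over `n`; the
    -- signals only add to it.
    have h5 : 0 < δ * s * (3 / 8 - δ / 8) := mul_pos (mul_pos hδ hs0) (by linarith)
    nlinarith

/-- Bounds on the expected number of null observations beyond the two thresholds. -/
lemma null_count_mean_bounds (h : IsSlabDensity γ Λ κ) {t : ℝ} (ht : t ∈ Ioo (0 : ℝ) 1)
    {n s : ℕ} (hn : 0 < n) {δ w ξ₁ ξ₂ : ℝ} (hδ : 0 < δ) (hδ1 : δ ≤ 1 / 12) (hw : 0 < w)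
    (hwδ : w ≤ δ / 8) (hσ : excess γ w = s / n) (hσδ : (s : ℝ) / n ≤ δ / 8)
    (hξ₁ : IsGoodThreshold γ t δ ((1 - δ) * w) ξ₁) (hξ₂ : IsGoodThreshold γ t δ ((1 + δ) * w) ξ₂) :
    n * (2 * PhiBar ξ₂) ≤ (1 + 5 * δ) * (t / (1 - t) * s) ∧
    n * (2 * PhiBar ξ₁) ≤ t / (1 - t) * s ∧
    (1 - 5 * δ) * (t / (1 - t) * s) ≤ ((n : ℝ) - s) * (2 * PhiBar ξ₁) := by
  obtain ⟨b1, b2, b3, b4⟩ := excess_bounds h hδ hδ1 hw hwδ hσ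
  have hn0 : (0 : ℝ) < n := by exact_mod_cast hn
  have hs0 : (0 : ℝ) ≤ s := Nat.cast_nonneg s
  have hc : 0 < t / (1 - t) := div_pos ht.1 (by linarith [ht.2])
  set c := t / (1 - t)
  have hcs : 0 ≤ c * s := mul_nonneg hc.le hs0
  have hsn : (s : ℝ) / n * n = s := div_mul_cancel₀ _ hn0.ne'
  have hsnle : (s : ℝ) ≤ δ / 8 * n := by rwa [div_le_iff₀ hn0] at hσδ
  have hns : 0 ≤ (n : ℝ) - s := by nlinarith
  have hd : 0 ≤ 1 - δ := by linarith
  have pow4 : (1 + δ) ^ 4 ≤ 1 + 5 * δ := by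
    have h2 : (1 + δ) ^ 2 ≤ 1 + 2 * δ + δ / 12 := by nlinarith
    calc (1 + δ) ^ 4 = ((1 + δ) ^ 2) ^ 2 := by ring
      _ ≤ (1 + 2 * δ + δ / 12) ^ 2 := pow_le_pow_left₀ (sq_nonneg _) h2 2
      _ ≤ _ := by nlinarith
  have pow4' : 1 - 4 * δ ≤ (1 - δ) ^ 4 := by
    have := one_add_mul_le_pow (by linarith : -2 ≤ -δ) 4
    calc 1 - 4 * δ = 1 + ((4 : ℕ) : ℝ) * -δ := by push_cast; ring
      _ ≤ _ := this
      _ = _ := by ring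
  refine ⟨?_, ?_, ?_⟩
  · calc n * (2 * PhiBar ξ₂) ≤ n * ((1 + δ) * (c * ((1 + δ) ^ 3 * (s / n)))) := by
          refine mul_le_mul_of_nonneg_left (hξ₂.tail_le.trans ?_) hn0.le
          gcongr
      _ = (1 + δ) ^ 4 * (c * (s / n * n)) := by ring
      _ ≤ _ := by rw [hsn]; exact mul_le_mul_of_nonneg_right pow4 hcs
  · calc n * (2 * PhiBar ξ₁) ≤ n * ((1 + δ) * (c * ((1 - δ) * (s / n)))) := by
          refine mul_le_mul_of_nonneg_left (hξ₁.tail_le.trans ?_) hn0.le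
          gcongr
      _ = (1 - δ ^ 2) * (c * (s / n * n)) := by ring
      _ ≤ _ := by
          rw [hsn]
          exact mul_le_of_le_one_left hcs (by linarith [sq_nonneg δ])
  · calc (1 - 5 * δ) * (c * s) ≤ ((1 - δ / 8) * (1 - δ) ^ 4) * (c * s) := by
          refine mul_le_mul_of_nonneg_right ?_ hcs
          nlinarith
      _ = ((1 - δ / 8) * n) * ((1 - δ) * (c * ((1 - δ) ^ 3 * (s / n)))) := by
          rw [← hsn]; field_simp
      _ ≤ ((n : ℝ) - s) * ((1 - δ) * (c * ((1 - δ) ^ 3 * (s / n)))) := by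
          refine mul_le_mul_of_nonneg_right (by linarith) (by positivity)
      _ ≤ _ := by
          refine mul_le_mul_of_nonneg_left (le_trans ?_ hξ₁.le_tail) hns
          gcongr

set_option maxHeartbeats 1000000 in
/-- The false discovery rate of a procedure that thresholds `q`-values at the estimated weight,
whenever this weight is near its target. -/
theorem abs_FDR_sub_le (h : IsSlabDensity γ Λ κ) {t : ℝ} (ht : t ∈ Ioo (0 : ℝ) 1)
    {n s : ℕ} (hn : 0 < n) {θ : Fin n → ℝ}
    (hcard : (Finset.univ.filter fun i => θ i ≠ 0).card = s) (hs : 2 ≤ s)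
    {δ w ξ₁ ξ₂ p : ℝ} (hδ : 0 < δ) (hδ1 : δ ≤ 1 / 12) (hw : 0 < w) (hwδ : w ≤ δ / 8)
    (hwn : 1 / (n : ℝ) ≤ (1 - δ) * w) (hσ : excess γ w = s / n) (hσδ : (s : ℝ) / n ≤ δ / 8)
    (hξ₁ : IsGoodThreshold γ t δ ((1 - δ) * w) ξ₁) (hξ₂ : IsGoodThreshold γ t δ ((1 + δ) * w) ξ₂)
    (hp : ∀ i, θ i ≠ 0 → (gaussianReal (θ i) 1).real {y | |y| < ξ₁ + 1} ≤ p)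
    {φ : (Fin n → ℝ) → Finset (Fin n)} (hφm : ∀ i, MeasurableSet {x | i ∈ φ x})
    (hφ : ∀ x, (1 - δ) * w ≤ wHat γ x → ∀ i, i ∈ φ x ↔ qValue γ (wHat γ x) (x i) ≤ t) :
    |FDR θ φ - t| ≤ 24 * δ + (32 / δ ^ 2 + 4 * (1 - t) / (t * δ ^ 2)) / s + 8 * p / δ := by
  obtain ⟨b1, b2, b3, b4⟩ := excess_bounds h hδ hδ1 hw hwδ hσ
  have hn0 : (0 : ℝ) < n := by exact_mod_cast hn
  have hs0 : (0 : ℝ) < s := by exact_mod_cast (by omega : 0 < s)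
  have ht1 : 0 < 1 - t := by linarith [ht.2]
  obtain ⟨c, hc_def⟩ : ∃ c, c = t / (1 - t) := ⟨_, rfl⟩
  have hc : 0 < c := hc_def ▸ div_pos ht.1 ht1
  have hcs : 0 < c * s := mul_pos hc hs0
  have hsn : (s : ℝ) / n * n = s := div_mul_cancel₀ _ hn0.ne'
  have hσ0 : 0 ≤ (s : ℝ) / n := by positivity
  have hsnle : (s : ℝ) ≤ δ / 8 * n := by rwa [div_le_iff₀ hn0] at hσδ
  have hw₁ : 0 < (1 - δ) * w := mul_pos (by linarith) hw
  have hw₂ : (1 + δ) * w ≤ 1 / 2 := by nlinarith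
  have hle : (1 - δ) * w ≤ (1 + δ) * w := by nlinarith
  have hm0 := card_null hcard
  have hns : 0 ≤ (n : ℝ) - s := by nlinarith
  have hn1 : 0 ≤ 2 * PhiBar ξ₁ := by linarith [PhiBar_nonneg ξ₁]
  have hn2 : 0 ≤ 2 * PhiBar ξ₂ := by linarith [PhiBar_nonneg ξ₂]
  have hr : 0 < δ / 2 * s := by positivity
  have hr' : 0 < c * δ * s := by positivity
  have pow3 : (1 + δ) ^ 3 ≤ 2 := by nlinarith [mul_pos hδ hδ, pow_pos hδ 3]
  obtain ⟨q₂, q₁, q₁'⟩ := null_count_mean_bounds h ht hn hδ hδ1 hw hwδ hσ hσδ hξ₁ hξ₂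
  rw [← hc_def] at q₂ q₁ q₁'
  set m : ℝ := ((Finset.univ.filter fun i => θ i = 0).card : ℝ)
  -- Off `E₁`, `E₂` and `E₅` the estimator is located; off `E₃` and `E₄` the null counts at the two
  -- thresholds are close to their means; off `E₅` few signals are missed. In the first four, a
  -- variance of order `s` against a squared deviation of order `δ² s²` yields a bound of order `1 /
  -- s`.
  set E₁ := {x : Fin n → ℝ | δ / 2 * s ≤ |∑ i with θ i = 0, invRatio γ ((1 - δ) * w) (x i) -
    m * (1 + excess γ ((1 - δ) * w))|}
  set E₂ := {x : Fin n → ℝ | δ / 2 * s ≤ |∑ i with θ i = 0, invRatio γ ((1 + δ) * w) (x i) -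
    m * (1 + excess γ ((1 + δ) * w))|}
  set E₃ := {x : Fin n → ℝ | c * δ * s ≤ |∑ i with θ i = 0, {y : ℝ | ξ₁ ≤ |y|}.indicator 1 (x i) -
    m * (2 * PhiBar ξ₁)|}
  set E₄ := {x : Fin n → ℝ | c * δ * s ≤ |∑ i with θ i = 0, {y : ℝ | ξ₂ ≤ |y|}.indicator 1 (x i) -
    m * (2 * PhiBar ξ₂)|}
  set E₅ := {x : Fin n → ℝ | δ / 8 * s ≤
    ∑ i with θ i ≠ 0, {y : ℝ | |y| < ξ₁ + 1}.indicator 1 (x i)}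
  have hE₁ : (dataLaw θ).real E₁ ≤ 16 / δ ^ 2 / s := by
    refine (dataLaw_null_invRatio_deviation h θ ⟨hw₁.le, hle.trans hw₂⟩ hr).trans ?_
    have : n * (2 * excess γ ((1 - δ) * w)) ≤ 4 * s := by
      calc n * (2 * excess γ ((1 - δ) * w)) ≤ n * (2 * ((1 - δ) * (s / n))) := by gcongr
        _ = 2 * (1 - δ) * (s / n * n) := by ring
        _ ≤ 4 * s := by rw [hsn]; nlinarith
    calc _ ≤ 4 * s / (δ / 2 * s) ^ 2 := by gcongr
      _ = 16 / δ ^ 2 / s := by field_simp; norm_num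
  have hE₂ : (dataLaw θ).real E₂ ≤ 16 / δ ^ 2 / s := by
    refine (dataLaw_null_invRatio_deviation h θ ⟨hw₁.le.trans hle, hw₂⟩ hr).trans ?_
    have : n * (2 * excess γ ((1 + δ) * w)) ≤ 4 * s := by
      calc n * (2 * excess γ ((1 + δ) * w)) ≤ n * (2 * ((1 + δ) ^ 3 * (s / n))) := by gcongr
        _ = 2 * (1 + δ) ^ 3 * (s / n * n) := by ring
        _ ≤ 4 * s := by rw [hsn]; nlinarith
    calc _ ≤ 4 * s / (δ / 2 * s) ^ 2 := by gcongr
      _ = 16 / δ ^ 2 / s := by field_simp; norm_num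
  have hE₃ : (dataLaw θ).real E₃ ≤ 2 * (1 - t) / (t * δ ^ 2) / s := by
    refine (dataLaw_null_count_deviation θ (by linarith [hξ₁.one_le]) hr').trans ?_
    calc _ ≤ 2 * (c * s) / (c * δ * s) ^ 2 :=
          div_le_div_of_nonneg_right (q₁.trans (by linarith)) (sq_nonneg _)
      _ = 2 * (1 - t) / (t * δ ^ 2) / s := by
          have := ht.1.ne'
          rw [hc_def]; field_simp
  have hE₄ : (dataLaw θ).real E₄ ≤ 2 * (1 - t) / (t * δ ^ 2) / s := by
    refine (dataLaw_null_count_deviation θ (by linarith [hξ₂.one_le]) hr').trans ?_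
    calc _ ≤ 2 * (c * s) / (c * δ * s) ^ 2 :=
          div_le_div_of_nonneg_right (q₂.trans (mul_le_mul_of_nonneg_right (by linarith) hcs.le))
            (sq_nonneg _)
      _ = 2 * (1 - t) / (t * δ ^ 2) / s := by
          have := ht.1.ne'
          rw [hc_def]; field_simp
  have hE₅ : (dataLaw θ).real E₅ ≤ 8 * p / δ := by
    refine (dataLaw_signal_count θ (measurableSet_lt measurable_abs measurable_const) hp
      (by positivity)).trans ?_
    rw [hcard]
    refine le_of_eq ?_
    field_simp
  have hE : (dataLaw θ).real (E₁ ∪ E₂ ∪ E₃ ∪ E₄ ∪ E₅) ≤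
      (32 / δ ^ 2 + 4 * (1 - t) / (t * δ ^ 2)) / s + 8 * p / δ := by
    have u1 := measureReal_union_le (μ := dataLaw θ) (E₁ ∪ E₂ ∪ E₃ ∪ E₄) E₅
    have u2 := measureReal_union_le (μ := dataLaw θ) (E₁ ∪ E₂ ∪ E₃) E₄
    have u3 := measureReal_union_le (μ := dataLaw θ) (E₁ ∪ E₂) E₃
    have u4 := measureReal_union_le (μ := dataLaw θ) E₁ E₂
    have e : (32 / δ ^ 2 + 4 * (1 - t) / (t * δ ^ 2)) / s = 16 / δ ^ 2 / s + 16 / δ ^ 2 / s +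
        2 * (1 - t) / (t * δ ^ 2) / s + 2 * (1 - t) / (t * δ ^ 2) / s := by ring
    rw [e]; linarith
  rw [add_assoc]
  refine abs_integral_sub_le (measurable_comp_finset hφm fun R =>
    ((R.filter fun i => θ i = 0).card : ℝ) / max 1 (R.card : ℝ)) (by positivity) (fun x => ?_)
    (B := E₁ ∪ E₂ ∪ E₃ ∪ E₄ ∪ E₅) (fun x hx => ?_) hE
  · have l1 : (0 : ℝ) ≤ ((φ x).filter fun i => θ i = 0).card / max 1 ((φ x).card : ℝ) := by
      positivity
    have l2 : (((φ x).filter fun i => θ i = 0).card : ℝ) / max 1 ((φ x).card : ℝ) ≤ 1 := by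
      rw [div_le_one (by positivity)]
      refine le_max_of_le_right ?_
      exact_mod_cast Finset.card_filter_le _ _
    rw [abs_le]; constructor <;> linarith [ht.1, ht.2]
  · simp only [mem_union, not_or] at hx
    obtain ⟨⟨⟨⟨x1, x2⟩, x3⟩, x4⟩, x5⟩ := hx
    simp only [E₁, E₂, E₃, E₄, E₅, mem_ofPred_eq, not_le] at x1 x2 x3 x4 x5
    have hŵ := wHat_mem_Icc h hn hcard (by omega) hδ hδ1 hw hwδ hwn hσ hσδ hξ₁.invRatio_le
      x1 x2 x5.le
    -- `6 δ` is `5 δ` from the means and `δ` from the deviations; the error is then `4 · 6 δ`.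
    have := abs_fdp_sub_le h ht (by positivity : 0 ≤ 6 * δ) (by linarith) hcard hs hw₁
      (by linarith) hŵ hξ₁.qValue_le_iff hξ₂.qValue_le_iff (x := x) (R := φ x) (hφ x hŵ.1)
      ?_ ?_ ?_
    · linarith
    · have := (abs_lt.1 x3).1
      rw [hm0] at this
      rw [← hc_def]
      linarith
    · have h6 := (abs_lt.1 x4).2
      rw [hm0] at h6
      rw [← hc_def]
      have h7 : ((n : ℝ) - s) * (2 * PhiBar ξ₂) ≤ n * (2 * PhiBar ξ₂) :=
        mul_le_mul_of_nonneg_right (by linarith) hn2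
      linarith
    · linarith [mul_pos hδ hs0]

/-! ### Asymptotics -/

lemma exists_goodThreshold (h : IsSlabDensity γ Λ κ) {t : ℝ} (ht : t ∈ Ioo (0 : ℝ) 1) {δ : ℝ}
    (hδ : 0 < δ) (hδ1 : δ ≤ 1) :
    ∃ w₀ ∈ Ioo (0 : ℝ) (1 / 2), ∀ w ∈ Ioc 0 w₀, ∃ ξ, IsGoodThreshold γ t δ w ξ := by
  obtain ⟨w₀, hw₀, hw⟩ := exists_weight_threshold h ht (by positivity : 0 < δ / 4) (by linarith)
  refine ⟨w₀, hw₀, fun w hww => ?_⟩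
  obtain ⟨ξ, h1, h2, h3, h4, h5⟩ := hw w hww
  have hc : 0 < t / (1 - t) := div_pos ht.1 (by linarith [ht.2])
  have hX : 0 ≤ t / (1 - t) * excess γ w :=
    mul_nonneg hc.le (excess_nonneg h ⟨hww.1.le, by linarith [hww.2, hw₀.2]⟩)
  exact ⟨ξ, h1, h2, le_trans (mul_le_mul_of_nonneg_right (by linarith) hX) h3,
    h4.trans (mul_le_mul_of_nonneg_right (by linarith) hX), h5⟩

/-- From `k / N ≤ 2 Φ̄(ξ) ≤ e^{-ξ²/2}`, `ξ² ≤ 2 log N + 2 |log k|`. With `N = n / s` this compares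
the threshold with the signal strength. -/
lemma threshold_le_sqrt {ξ k N : ℝ} (hξ : 1 ≤ ξ) (hk : 0 < k) (hN : 1 ≤ N)
    (hb : k * N⁻¹ ≤ 2 * PhiBar ξ) :
    ξ ≤ √(2 * Real.log N) + √(2 * |Real.log k|) := by
  have hN0 : 0 < N := by linarith
  have h1 := Real.log_le_log (by positivity) (hb.trans (two_mul_PhiBar_le_exp hξ))
  rw [Real.log_exp, Real.log_mul hk.ne' (inv_ne_zero hN0.ne'), Real.log_inv] at h1
  have hl := Real.log_nonneg hN
  have ha := neg_abs_le (Real.log k)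
  have e1 := Real.sq_sqrt (by positivity : 0 ≤ 2 * Real.log N)
  have e2 := Real.sq_sqrt (by positivity : 0 ≤ 2 * |Real.log k|)
  refine le_of_sq_le_sq ?_ (by positivity)
  nlinarith [Real.sqrt_nonneg (2 * Real.log N), Real.sqrt_nonneg (2 * |Real.log k|),
    mul_nonneg (Real.sqrt_nonneg (2 * Real.log N)) (Real.sqrt_nonneg (2 * |Real.log k|))]

/-- The intermediate value theorem on `[0, w₁]`: the excess is continuous, zero at `0` and positive
at `w₁`. Taking `w₁ ≤ w₀ / 2` keeps `(1 + δ) w` in the range where good thresholds exist. -/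
lemma exists_weight_excess_eq (h : IsSlabDensity γ Λ κ) {t : ℝ} (ht : t ∈ Ioo (0 : ℝ) 1)
    {δ : ℝ} (hδ : 0 < δ) (hδ1 : δ ≤ 1 / 12) :
    ∃ σ₀ > 0, ∀ σ ∈ Ioo 0 σ₀, ∃ w > 0, w ≤ δ / 8 ∧ excess γ w = σ ∧
      ∃ ξ₁ ξ₂, IsGoodThreshold γ t δ ((1 - δ) * w) ξ₁ ∧
        IsGoodThreshold γ t δ ((1 + δ) * w) ξ₂ := by
  obtain ⟨w₀, hw₀, hw⟩ := exists_goodThreshold h ht hδ (by linarith)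
  set w₁ := min (w₀ / 2) (δ / 8)
  have hw₁ : 0 < w₁ := lt_min (by linarith [hw₀.1]) (by linarith)
  have hw₁0 : w₁ ≤ w₀ / 2 := min_le_left _ _
  obtain ⟨ξ, hξ⟩ := hw w₁ ⟨hw₁, by linarith [hw₀.1]⟩
  have hpos : 0 < excess γ w₁ := excess_pos ht (by linarith [hξ.one_le]) (by linarith) hξ.tail_le
  refine ⟨excess γ w₁, hpos, fun σ hσ => ?_⟩
  have hcont := (continuousOn_excess h).mono
    (Icc_subset_Icc_right (by linarith [hw₀.2] : w₁ ≤ 1 / 2))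
  obtain ⟨w, hwm, hwσ⟩ := intermediate_value_Ioo hw₁.le hcont (by rw [excess_zero]; exact hσ)
  have hww : w ≤ w₀ / 2 := hwm.2.le.trans hw₁0
  obtain ⟨ξ₁, hξ₁⟩ := hw ((1 - δ) * w)
    ⟨mul_pos (by linarith) hwm.1, by nlinarith [hwm.1, hw₀.1]⟩
  obtain ⟨ξ₂, hξ₂⟩ := hw ((1 + δ) * w)
    ⟨mul_pos (by linarith) hwm.1, by nlinarith [hwm.1, hw₀.1]⟩
  exact ⟨w, hwm.1, hwm.2.le.trans (min_le_right _ _), hwσ, ξ₁, ξ₂, hξ₁, hξ₂⟩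

lemma tendsto_div_zero_of_le_rpow {s : ℕ → ℕ} {υ : ℝ} (hυ : υ < 1)
    (hs : ∀ᶠ n : ℕ in atTop, (s n : ℝ) ≤ (n : ℝ) ^ υ) :
    Tendsto (fun n : ℕ => (s n : ℝ) / n) atTop (𝓝 0) := by
  have h1 : Tendsto (fun n : ℕ => (n : ℝ) ^ (-(1 - υ))) atTop (𝓝 0) :=
    (tendsto_rpow_neg_atTop (by linarith)).comp tendsto_natCast_atTop_atTop
  refine squeeze_zero' (Eventually.of_forall fun n => by positivity) ?_ h1
  filter_upwards [hs, eventually_gt_atTop 0] with n hn hn0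
  have hn0' : (0 : ℝ) < n := by exact_mod_cast hn0
  rw [div_le_iff₀ hn0', ← Real.rpow_add_one hn0'.ne']
  rwa [show -(1 - υ) + 1 = υ by ring]

/-- Uniform control of the false discovery rate over the large signals, for every procedure that
thresholds the `q`-values whenever the estimated weight is not too small. -/
theorem eventually_abs_FDR_sub_le (h : IsSlabDensity γ Λ κ) {a : ℝ} (ha : 1 < a) {s : ℕ → ℕ}
    (hs : Tendsto s atTop atTop) (hsn : Tendsto (fun n : ℕ => (s n : ℝ) / n) atTop (𝓝 0))
    {t : ℝ} (ht : t ∈ Ioo (0 : ℝ) 1) {ε : ℝ} (hε : 0 < ε) :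
    ∀ᶠ n : ℕ in atTop, ∀ θ ∈ largeSignals n (s n) a, ∀ φ : (Fin n → ℝ) → Finset (Fin n),
      (∀ i, MeasurableSet {x | i ∈ φ x}) →
      (∀ x, (s n : ℝ) / n < 2 * wHat γ x → ∀ i, i ∈ φ x ↔ qValue γ (wHat γ x) (x i) ≤ t) →
      |FDR θ φ - t| ≤ ε := by
  obtain ⟨δ, hδ, hδ1, hδε⟩ : ∃ δ > 0, δ ≤ 1 / 12 ∧ 24 * δ ≤ ε / 3 :=
    ⟨min (1 / 12) (ε / 72), by positivity, min_le_left _ _, by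
      have := min_le_right (1 / 12) (ε / 72); linarith⟩
  have hc : 0 < t / (1 - t) := div_pos ht.1 (by linarith [ht.2])
  obtain ⟨σ₀, hσ₀, hex⟩ := exists_weight_excess_eq h ht hδ hδ1
  set p := ε * δ / 24 with hp_def
  have hp : 0 < p := by positivity
  set k := (1 - δ) ^ 4 * (t / (1 - t)) with hk_def
  have hk : 0 < k := mul_pos (pow_pos (by linarith) 4) hc
  have hsR : Tendsto (fun n => (s n : ℝ)) atTop atTop := tendsto_natCast_atTop_atTop.comp hs
  have t1 : Tendsto (fun n => (32 / δ ^ 2 + 4 * (1 - t) / (t * δ ^ 2)) / (s n : ℝ)) atTop (𝓝 0) :=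
    tendsto_const_nhds.div_atTop hsR
  have t2 : Tendsto (fun n : ℕ => (n : ℝ) / s n) atTop atTop := by
    have : Tendsto (fun n : ℕ => (s n : ℝ) / n) atTop (𝓝[>] 0) := by
      rw [tendsto_nhdsWithin_iff]
      refine ⟨hsn, ?_⟩
      filter_upwards [hs.eventually_gt_atTop 0, eventually_gt_atTop 0] with n h1 h2
      have h1' : (0 : ℝ) < s n := by exact_mod_cast h1
      have h2' : (0 : ℝ) < n := by exact_mod_cast h2
      exact div_pos h1' h2'
    refine this.inv_tendsto_nhdsGT_zero.congr fun n => ?_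
    simp
  -- The gap between the signals and the leading term of the threshold, where `a > 1` is essential.
  -- It eventually absorbs the bounded part of the threshold and leaves `p⁻¹ + 1` for Chebyshev.
  have t3 : Tendsto (fun n : ℕ => (a - 1) * √(2 * Real.log ((n : ℝ) / s n))) atTop atTop :=
    Tendsto.const_mul_atTop (by linarith) (Real.tendsto_sqrt_atTop.comp
      (Tendsto.const_mul_atTop (by norm_num) (Real.tendsto_log_atTop.comp t2)))
  filter_upwards [hs.eventually_ge_atTop 2, eventually_gt_atTop 0,
    t1.eventually_le_const (by positivity : 0 < ε / 3), t2.eventually_ge_atTop 1,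
    t3.eventually_ge_atTop (√(2 * |Real.log k|) + 1 + (p⁻¹ + 1)),
    hsn.eventually_lt_const hσ₀, hsn.eventually_le_const (by positivity : 0 < δ / 8)]
    with n hs2 hn e1 e2 e3 e4 e5 θ hθ φ hφm hφ
  have hn0 : (0 : ℝ) < n := by exact_mod_cast hn
  have hs2' : (2 : ℝ) ≤ s n := by exact_mod_cast hs2
  have hσpos : 0 < (s n : ℝ) / n := by positivity
  obtain ⟨w, hw, hwδ, hwσ, ξ₁, ξ₂, hξ₁, hξ₂⟩ := hex _ ⟨hσpos, e4⟩
  -- From `s / n = excess γ w ≤ w / (1 - w)`. With `s ≥ 2` it also keeps the lower end `(1 - δ) w`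
  -- above `1 / n`.
  have hlow : (s n : ℝ) / n < 2 * ((1 - δ) * w) := by
    have h1 := excess_le h (w := w) ⟨hw.le, by linarith⟩
    rw [hwσ, le_div_iff₀ (by linarith)] at h1
    have h2 : 1 < 2 * ((1 - δ) * (1 - w)) := by nlinarith
    have h3 : (s n : ℝ) / n * 1 < (s n : ℝ) / n * (2 * ((1 - δ) * (1 - w))) :=
      mul_lt_mul_of_pos_left h2 hσpos
    have h4 := mul_le_mul_of_nonneg_left h1 (by linarith : 0 ≤ 1 - δ)
    linarith
  have hwn : 1 / (n : ℝ) ≤ (1 - δ) * w := by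
    have : 2 * (1 / (n : ℝ)) ≤ (s n : ℝ) / n := by
      rw [mul_one_div]; gcongr
    linarith
  have hξb : ξ₁ ≤ √(2 * Real.log ((n : ℝ) / s n)) + √(2 * |Real.log k|) := by
    refine threshold_le_sqrt hξ₁.one_le hk e2 (le_trans ?_ hξ₁.le_tail)
    have b4 := (excess_bounds h hδ hδ1 hw hwδ hwσ).2.2.2
    rw [inv_div, hk_def]
    calc (1 - δ) ^ 4 * (t / (1 - t)) * ((s n : ℝ) / n)
        = (1 - δ) * (t / (1 - t) * ((1 - δ) ^ 3 * ((s n : ℝ) / n))) := by ring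
      _ ≤ _ := mul_le_mul_of_nonneg_left (mul_le_mul_of_nonneg_left b4 hc.le) (by linarith)
  have hpb : ∀ i, θ i ≠ 0 → (gaussianReal (θ i) 1).real {y | |y| < ξ₁ + 1} ≤ p := by
    intro i hi
    have h1 := hθ.1 i hi
    have hp' : 0 < p⁻¹ := inv_pos.2 hp
    have h2 : p⁻¹ + 1 ≤ |θ i| - (ξ₁ + 1) := by linarith
    refine (gaussianReal_abs_lt_le (by linarith)).trans ?_
    rw [one_div, inv_le_comm₀ (by nlinarith) hp]
    nlinarith
  have := abs_FDR_sub_le h ht hn hθ.2 hs2 hδ hδ1 hw hwδ hwn hwσ e5 hξ₁ hξ₂ hpb hφm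
    fun x hx => hφ x (by linarith)
  have e : 8 * p / δ = ε / 3 := by rw [hp_def]; field_simp; norm_num
  rw [e] at this
  linarith

lemma largeSignals_nonempty {n s : ℕ} (hs : s ≤ n) {a : ℝ} (ha : 0 ≤ a) :
    (largeSignals n s a).Nonempty := by
  obtain ⟨T, -, hT⟩ := Finset.exists_subset_card_eq (s := (Finset.univ : Finset (Fin n))) (n := s)
    (by simpa using hs)
  set r := a * √(2 * Real.log ((n : ℝ) / s))
  have hr : 0 ≤ r := by positivity
  refine ⟨fun i => if i ∈ T then r + 1 else 0, fun i hi => ?_, ?_⟩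
  · have hiT : i ∈ T := by by_contra hcon; simp [hcon] at hi
    simp only [hiT, if_true]
    rw [abs_of_pos (by linarith)]
    linarith
  · rw [← hT]
    congr 1
    ext i
    have : r + 1 ≠ 0 := by linarith
    by_cases hi : i ∈ T <;> simp [hi, this]

/-- Nonemptiness matters: over an empty index the real supremum and infimum take the default value
`0`. -/
lemma tendsto_iSup_iInf {ι : ℕ → Type*} {F : ∀ n, ι n → ℝ} {t : ℝ}
    (hne : ∀ᶠ n in atTop, Nonempty (ι n))
    (hF : ∀ ε > 0, ∀ᶠ n in atTop, ∀ i, |F n i - t| ≤ ε) :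
    Tendsto (fun n => ⨆ i, F n i) atTop (𝓝 t) ∧ Tendsto (fun n => ⨅ i, F n i) atTop (𝓝 t) := by
  constructor <;>
  · rw [Metric.tendsto_atTop']
    intro ε hε
    obtain ⟨N, hN⟩ := eventually_atTop.1 (hne.and (hF (ε / 2) (by positivity)))
    refine ⟨N, fun n hn => ?_⟩
    obtain ⟨⟨i₀⟩, hb⟩ := hN n hn.le
    have hne' : Nonempty (ι n) := ⟨i₀⟩
    have hu : ∀ i, F n i ≤ t + ε / 2 := fun i => by linarith [(abs_le.1 (hb i)).2]
    have hl : ∀ i, t - ε / 2 ≤ F n i := fun i => by linarith [(abs_le.1 (hb i)).1]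
    have hbu : BddAbove (range (F n)) := ⟨_, by rintro _ ⟨i, rfl⟩; exact hu i⟩
    have hbl : BddBelow (range (F n)) := ⟨_, by rintro _ ⟨i, rfl⟩; exact hl i⟩
    have s1 := ciSup_le hu
    have s2 := (hl i₀).trans (le_ciSup hbu i₀)
    have s3 := le_ciInf hl
    have s4 := (ciInf_le hbl i₀).trans (hu i₀)
    rw [Real.dist_eq, abs_lt]
    constructor <;> linarith

/-- `Ḡ(√(2.1 log n)) ≥ Ḡ(0) e^{-Λ √(2.1 log n)} ≥ Ḡ(0) n^{-δ/2}` for large `n`, so `s Ḡ` is at least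
a multiple of `n^{δ/2}`, which beats `2 log n`. -/
lemma eventually_two_mul_omega_le (h : IsSlabDensity γ Λ κ) {s : ℕ → ℕ} {L : ℕ → ℝ} {δ : ℝ}
    (hδ : 0 < δ) (hs : ∀ᶠ n : ℕ in atTop, (n : ℝ) ^ δ ≤ s n)
    (hL : ∀ᶠ n : ℕ in atTop, L n ≤ Real.log n) :
    ∀ᶠ n : ℕ in atTop, 2 * omega γ n (L n) ≤ (s n : ℝ) / n := by
  have hG0 := GBar_pos h 0
  have hΛ := h.lipschitz_const_nonneg
  have tlog : Tendsto (fun n : ℕ => Real.log n) atTop atTop :=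
    Real.tendsto_log_atTop.comp tendsto_natCast_atTop_atTop
  have t1 : Tendsto (fun n : ℕ => Real.exp (Real.log n * (δ / 2)) / (Real.log n * (δ / 2)) ^ 1)
      atTop atTop :=
    (Real.tendsto_exp_div_pow_atTop 1).comp (tlog.atTop_mul_const (by positivity))
  filter_upwards [hs, hL, t1.eventually_ge_atTop (4 / (δ * GBar γ 0)),
    tlog.eventually_ge_atTop (8.4 * Λ ^ 2 / δ ^ 2), tlog.eventually_gt_atTop 0,
    eventually_gt_atTop 0] with n e1 e2 e3 e4 e5 hn
  have hn0 : (0 : ℝ) < n := by exact_mod_cast hn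
  set y := Real.log n
  have hG := GBar_pos h (√(2.1 * y))
  -- After squaring this is `y ≥ 8.4 Λ² / δ²`.
  have hsq : Λ * √(2.1 * y) ≤ y * (δ / 2) := by
    refine le_of_sq_le_sq ?_ (by positivity)
    rw [mul_pow, Real.sq_sqrt (by positivity)]
    rw [div_le_iff₀ (by positivity)] at e4
    nlinarith
  have hGl : GBar γ 0 * Real.exp (-(y * (δ / 2))) ≤ GBar γ (√(2.1 * y)) := by
    refine le_trans ?_ (GBar_zero_le h (Real.sqrt_nonneg _))
    gcongr
  have hexp : 2 * y ≤ GBar γ 0 * Real.exp (y * (δ / 2)) := by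
    rw [pow_one, div_le_div_iff₀ (by positivity) (by positivity)] at e3
    have : 2 * y * δ ≤ GBar γ 0 * Real.exp (y * (δ / 2)) * δ := by linarith
    exact le_of_mul_le_mul_right this hδ
  have hsn : Real.exp (y * δ) ≤ s n := by
    rw [Real.rpow_def_of_pos hn0] at e1; exact e1
  have key : 2 * L n ≤ s n * GBar γ (√(2.1 * y)) := by
    calc 2 * L n ≤ 2 * y := by linarith
      _ ≤ GBar γ 0 * Real.exp (y * (δ / 2)) := hexp
      _ = Real.exp (y * δ) * (GBar γ 0 * Real.exp (-(y * (δ / 2)))) := by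
          rw [mul_left_comm, ← Real.exp_add]; congr 2; ring
      _ ≤ _ := by gcongr
  rw [omega, mul_div_assoc', div_le_div_iff₀ (by positivity) hn0]
  calc 2 * L n * n ≤ s n * GBar γ (√(2.1 * y)) * n := mul_le_mul_of_nonneg_right key hn0.le
    _ = _ := by ring

end SpikeSlab

end

/-! ### Limits for EBayesq and EBayesq.0 -/

theorem theorem3 (γ : ℝ → ℝ) (Λ κ : ℝ) (hγ : SpikeSlab.IsSlabDensity γ Λ κ)
    (a : ℝ) (ha : 1 < a) (υ : ℝ) (hυ : υ ∈ Set.Ioo (0 : ℝ) 1)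
    (s : ℕ → ℕ) (hs : Tendsto s atTop atTop)
    (hsυ : ∀ᶠ n : ℕ in atTop, (s n : ℝ) ≤ (n : ℝ) ^ υ)
    (t : ℝ) (ht : t ∈ Set.Ioo (0 : ℝ) 1) :
    (Tendsto (fun n : ℕ => ⨆ θ : SpikeSlab.largeSignals n (s n) a,
        SpikeSlab.FDR θ.1 (SpikeSlab.eBayesQ γ t)) atTop (𝓝 t) ∧
      Tendsto (fun n : ℕ => ⨅ θ : SpikeSlab.largeSignals n (s n) a,
        SpikeSlab.FDR θ.1 (SpikeSlab.eBayesQ γ t)) atTop (𝓝 t)) ∧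
    ∀ L : ℕ → ℝ, Tendsto L atTop atTop →
      ((∀ᶠ n : ℕ in atTop, 2 * SpikeSlab.omega γ n (L n) ≤ (s n : ℝ) / n) →
        Tendsto (fun n : ℕ => ⨆ θ : SpikeSlab.largeSignals n (s n) a,
          SpikeSlab.FDR θ.1 (SpikeSlab.eBayesQZero γ t (L n))) atTop (𝓝 t) ∧
        Tendsto (fun n : ℕ => ⨅ θ : SpikeSlab.largeSignals n (s n) a,
          SpikeSlab.FDR θ.1 (SpikeSlab.eBayesQZero γ t (L n))) atTop (𝓝 t)) ∧
      ((∃ δ : ℝ, 0 < δ ∧ ∀ᶠ n : ℕ in atTop, (n : ℝ) ^ δ ≤ s n) →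
        (∀ᶠ n : ℕ in atTop, L n ≤ Real.log n) →
        ∀ᶠ n : ℕ in atTop, 2 * SpikeSlab.omega γ n (L n) ≤ (s n : ℝ) / n) := by
  have hsn := SpikeSlab.tendsto_div_zero_of_le_rpow hυ.2 hsυ
  have hle : ∀ᶠ n : ℕ in atTop, s n ≤ n := by
    filter_upwards [hsn.eventually_le_const one_pos, eventually_gt_atTop 0] with n h1 h2
    rw [div_le_one (by exact_mod_cast h2)] at h1
    exact_mod_cast h1
  have hne : ∀ᶠ n : ℕ in atTop, Nonempty (SpikeSlab.largeSignals n (s n) a) :=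
    hle.mono fun n hn => (SpikeSlab.largeSignals_nonempty hn (by linarith)).to_subtype
  refine ⟨SpikeSlab.tendsto_iSup_iInf hne fun ε hε => ?_, fun L _ => ⟨fun hω =>
    SpikeSlab.tendsto_iSup_iInf hne fun ε hε => ?_, ?_⟩⟩
  · filter_upwards [SpikeSlab.eventually_abs_FDR_sub_le hγ ha hs hsn ht hε,
      eventually_gt_atTop 0] with n hn hn0 θ
    refine hn θ.1 θ.2 _ (SpikeSlab.measurableSet_mem_eBayesQ hγ hn0 t) fun x _ i => ?_
    simp [SpikeSlab.eBayesQ]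
  · filter_upwards [SpikeSlab.eventually_abs_FDR_sub_le hγ ha hs hsn ht hε,
      eventually_gt_atTop 0, hω] with n hn hn0 hωn θ
    refine hn θ.1 θ.2 _ (SpikeSlab.measurableSet_mem_eBayesQZero hγ hn0 t (L n)) fun x hx i => ?_
    -- `2 ω ≤ s / n < 2 ŵ`: at these data points EBayesq.0 coincides with EBayesq.
    have : SpikeSlab.omega γ n (L n) < SpikeSlab.wHat γ x := by linarith
    simp [SpikeSlab.eBayesQZero, this]
  · rintro ⟨δ, hδ, hδs⟩ hL
    exact SpikeSlab.eventually_two_mul_omega_le hγ hδ hδs hL
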